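/- Let $S^1=\mathbb R/2\pi\mathbb Z$, let $\mathrm{Diff}^+(S^1)$ be the group of orientation preserving smooth diffeomorphisms of $S^1$, and let $c(\varphi,\psi)=\int_{S^1}\log(\varphi'\circ\psi)\,d\log\psi'$ be the Bott cocycle. The Virasoro–Bott group is the Lie group $S^1\times_c\mathrm{Diff}^+(S^1)$ with the product $(\varphi,\alpha)(\psi,\beta)=(\varphi\circ\psi,\ \alpha\beta\,e^{2\pi i c(\varphi,\psi)})$, where $\alpha,\beta$ are complex numbers of modulus $1$. Identify its tangent space at the unit with $\mathfrak X(S^1)\times\mathbb R$, where $\mathfrak X(S^1)=C^\infty(S^1,\mathbb R)$ and $a\in\mathbb R$ stands for the tangent vector $4\pi i a$ of the circle at $1$. Every pair $(h,a)$ is the velocity at the unit of a smooth curve in the group. 1. With this identification the Lie algebra of the group (its bracket being the derivative of the adjoint action, $[X,Y]=\partial_t|_0\,\mathrm{Ad}(\gamma(t))Y$ for every smooth curve $\gamma$ with $\gamma(0)=e$ and $\gamma'(0)=X$) is the central extension $\mathbb R\times_\omega\mathfrak X(S^1)$, with bracket $$[(h,a),(k,b)]=(h'k-hk',\ \omega(h,k)),\qquad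 \omega(h,k)=\int_{S^1}h'k''\,dx .$$ 2. For the inner product $\langle(h,a),(k,b)\rangle=\int_{S^1}hk\,dx+ab$ the adjoint of $\mathrm{ad}(h,a)$ exists, is unique, and is given by $$\mathrm{ad}(h,a)^\top(\ell,c)=(2h'\ell+h\ell'+c\,h''',\ 0).$$ 3. Equip the group with the right invariant metric given by this inner product at the unit. Let $\gamma$ be a smooth curve in the group, defined on an open set that contains $[t_0,t_1]$, $t_0<t_1$. Then its right logarithmic derivative $(u(t),a(t))=T(\mu^{\gamma(t)^{-1}})\gamma'(t)$ (where $\mu^g$ is right translation by $g$) exists and is smooth in $t$ and $x$. The curve $\gamma$ is a geodesic on $[t_0,t_1]$, that is, a critical point of the energy $\tfrac12\int_{t_0}^{t_1}\langle(u,a),(u,a)\rangle\,dt$ for smooth variations with fixed end points, if and only if $a$ is constant on $[t_0,t_1]$ and $u$ satisfies the periodic Korteweg–de Vries equation $$u_t+3u\,u_x+a\,u_{xxx}=0\qquad\text{on }[t_0,t_1]\times S^1 .$$ -/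

import Mathlib

open Set Real MeasureTheory
open scoped ContDiff

noncomputable section

namespace VirasoroBott

/-! ### The Lie algebra `ℝ ×_ω 𝔛(S¹)`, where `S¹ = ℝ / 2πℤ` -/

/-- The smooth `2π`-periodic functions on `ℝ`. -/
def smoothPeriodic : Submodule ℝ (ℝ → ℝ) where
  carrier := {h | ContDiff ℝ ∞ h ∧ Function.Periodic h (2 * π)}
  add_mem' := fun hf hg => ⟨hf.1.add hg.1, hf.2.add hg.2⟩
  zero_mem' := ⟨contDiff_const, fun _ => rfl⟩
  smul_mem' := fun c _ hf => ⟨contDiff_const.mul hf.1, fun x => by simp [hf.2 x]⟩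

/-- `𝔛(S¹) = C^∞(S¹, ℝ)`: the vector field `h ∂ₓ` is identified with the smooth `2π`-periodic
function `h` on `ℝ`. -/
def VectS1 : Type := smoothPeriodic

instance : AddCommGroup VectS1 := inferInstanceAs (AddCommGroup smoothPeriodic)
instance : Module ℝ VectS1 := inferInstanceAs (Module ℝ smoothPeriodic)

instance : CoeFun VectS1 (fun _ => ℝ → ℝ) := ⟨Subtype.val⟩

theorem VectS1.contDiff (h : VectS1) : ContDiff ℝ ∞ (h : ℝ → ℝ) := h.2.1

theorem VectS1.periodic (h : VectS1) : Function.Periodic (h : ℝ → ℝ) (2 * π) := h.2.2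

@[ext] theorem VectS1.ext {h k : VectS1} (e : ∀ x, h x = k x) : h = k :=
  Subtype.ext (funext e)

@[simp] theorem VectS1.add_apply (h k : VectS1) (x : ℝ) : (h + k) x = h x + k x := rfl
@[simp] theorem VectS1.zero_apply (x : ℝ) : (0 : VectS1) x = 0 := rfl
@[simp] theorem VectS1.smul_apply (c : ℝ) (h : VectS1) (x : ℝ) : (c • h) x = c * h x := rfl

theorem contDiff_deriv {f : ℝ → ℝ} (hf : ContDiff ℝ ∞ f) : ContDiff ℝ ∞ (deriv f) :=
  (contDiff_infty_iff_deriv.1 hf).2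

theorem periodic_deriv {f : ℝ → ℝ} {T : ℝ} (hf : Function.Periodic f T) :
    Function.Periodic (deriv f) T := by
  intro x
  rw [← deriv_comp_add_const]
  congr 1
  funext y
  exact hf y

/-- The derivative `h ↦ h'`. -/
def VectS1.D (h : VectS1) : VectS1 :=
  ⟨deriv h, contDiff_deriv h.contDiff, periodic_deriv h.periodic⟩

theorem VectS1.differentiable (h : VectS1) : Differentiable ℝ (h : ℝ → ℝ) :=
  h.contDiff.differentiable (by simp)

@[simp] theorem VectS1.D_add (h k : VectS1) (x : ℝ) : (h + k).D x = h.D x + k.D x :=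
  deriv_add (h.differentiable x) (k.differentiable x)

@[simp] theorem VectS1.D_smul (c : ℝ) (h : VectS1) (x : ℝ) : (c • h).D x = c * h.D x :=
  deriv_const_mul c (h.differentiable x)

theorem VectS1.hasDerivAt (h : VectS1) (x : ℝ) : HasDerivAt (h : ℝ → ℝ) (h.D x) x :=
  (h.differentiable x).hasDerivAt

/-- The bracket `[h, k] = h' k - h k'` (the negative of the usual bracket of vector fields). -/
def VectS1.bracket (h k : VectS1) : VectS1 :=
  ⟨fun x => h.D x * k x - h x * k.D x,
    (h.D.contDiff.mul k.contDiff).sub (h.contDiff.mul k.D.contDiff), fun x => by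
      simp only [h.D.periodic x, k.periodic x, h.periodic x, k.D.periodic x]⟩

@[simp] theorem VectS1.bracket_apply (h k : VectS1) (x : ℝ) :
    h.bracket k x = h.D x * k x - h x * k.D x := rfl

@[simp] theorem VectS1.D_bracket (h k : VectS1) (x : ℝ) :
    (h.bracket k).D x = h.D.D x * k x - h x * k.D.D x := by
  have := ((h.D.hasDerivAt x).mul (k.hasDerivAt x)).sub ((h.hasDerivAt x).mul (k.D.hasDerivAt x))
  refine (this.deriv).trans ?_
  ring

/-- The Gelfand–Fuchs cocycle `ω(h, k) = ∫ h' k'' dx`. -/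
def omega (h k : VectS1) : ℝ := ∫ x in (0 : ℝ)..(2 * π), h.D x * k.D.D x

theorem VectS1.intervalIntegrable_mul (h k : VectS1) (a b : ℝ) :
    IntervalIntegrable (fun x => h x * k x) volume a b :=
  (h.contDiff.continuous.mul k.contDiff.continuous).intervalIntegrable a b

theorem VectS1.D_D_add (h k : VectS1) (x : ℝ) : (h + k).D.D x = h.D.D x + k.D.D x := by
  have : (h + k).D = h.D + k.D := VectS1.ext fun x => VectS1.D_add h k x
  rw [this, VectS1.D_add]

theorem VectS1.D_D_smul (c : ℝ) (h : VectS1) (x : ℝ) : (c • h).D.D x = c * h.D.D x := by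
  have : (c • h).D = c • h.D := VectS1.ext fun x => VectS1.D_smul c h x
  rw [this, VectS1.D_smul]

theorem omega_add_left (h k l : VectS1) : omega (h + k) l = omega h l + omega k l := by
  unfold omega
  rw [← intervalIntegral.integral_add (VectS1.intervalIntegrable_mul _ _ _ _)
    (VectS1.intervalIntegrable_mul _ _ _ _)]
  simp only [VectS1.D_add, add_mul]

theorem omega_add_right (h k l : VectS1) : omega h (k + l) = omega h k + omega h l := by
  unfold omega
  rw [← intervalIntegral.integral_add (VectS1.intervalIntegrable_mul _ _ _ _)
    (VectS1.intervalIntegrable_mul _ _ _ _)]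
  simp only [VectS1.D_D_add, mul_add]

theorem omega_smul_right (c : ℝ) (h k : VectS1) : omega h (c • k) = c * omega h k := by
  unfold omega
  rw [← intervalIntegral.integral_const_mul]
  simp only [VectS1.D_D_smul, mul_left_comm]

theorem omega_self (h : VectS1) : omega h h = 0 := by
  have h1 : ∀ x ∈ uIcc (0 : ℝ) (2 * π),
      HasDerivAt (fun x => h.D x ^ 2 / 2) (h.D x * h.D.D x) x := fun x _ => by
    convert! ((h.D.hasDerivAt x).pow 2).div_const 2 using 1
    simp
    ring
  unfold omega
  rw [intervalIntegral.integral_eq_sub_of_hasDerivAt h1 (VectS1.intervalIntegrable_mul _ _ _ _)]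
  have := h.D.periodic 0
  simp only [zero_add] at this
  rw [this, sub_self]

/-- The central extension `ℝ ×_ω 𝔛(S¹)`; the pair `(h, a)` stands for the column with entries
`h ∈ 𝔛(S¹)` and `a ∈ ℝ`. -/
def VirAlg : Type := VectS1 × ℝ

instance : AddCommGroup VirAlg := inferInstanceAs (AddCommGroup (VectS1 × ℝ))
instance : Module ℝ VirAlg := inferInstanceAs (Module ℝ (VectS1 × ℝ))

/-- `[(h, a), (k, b)] = (h' k - h k', ω(h, k))`. -/
instance : Bracket VirAlg VirAlg := ⟨fun X Y => (X.1.bracket Y.1, omega X.1 Y.1)⟩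

theorem VirAlg.bracket_def (X Y : VirAlg) : ⁅X, Y⁆ = (X.1.bracket Y.1, omega X.1 Y.1) := rfl

@[simp] theorem VirAlg.fst_add (X Y : VirAlg) : (X + Y).1 = X.1 + Y.1 := rfl
@[simp] theorem VirAlg.snd_add (X Y : VirAlg) : (X + Y).2 = X.2 + Y.2 := rfl
@[simp] theorem VirAlg.fst_zero : (0 : VirAlg).1 = 0 := rfl
@[simp] theorem VirAlg.snd_zero : (0 : VirAlg).2 = 0 := rfl
@[simp] theorem VirAlg.fst_smul (c : ℝ) (X : VirAlg) : (c • X).1 = c • X.1 := rfl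
@[simp] theorem VirAlg.snd_smul (c : ℝ) (X : VirAlg) : (c • X).2 = c * X.2 := rfl
@[simp] theorem VirAlg.fst_bracket (X Y : VirAlg) : ⁅X, Y⁆.1 = X.1.bracket Y.1 := rfl
@[simp] theorem VirAlg.snd_bracket (X Y : VirAlg) : ⁅X, Y⁆.2 = omega X.1 Y.1 := rfl

theorem VirAlg.ext {X Y : VirAlg} (h1 : ∀ x, X.1 x = Y.1 x) (h2 : X.2 = Y.2) : X = Y :=
  Prod.ext (VectS1.ext h1) h2

theorem omega_bracket (h k l : VectS1) :
    omega h (k.bracket l) = omega (h.bracket k) l + omega k (h.bracket l) := by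
  have e (h k : VectS1) (x : ℝ) :
      (h.bracket k).D.D x
        = h.D.D.D x * k x + h.D.D x * k.D x - h.D x * k.D.D x - h x * k.D.D.D x := by
    have hd := ((h.D.D.hasDerivAt x).mul (k.hasDerivAt x)).sub
      ((h.hasDerivAt x).mul (k.D.D.hasDerivAt x))
    have e2 : ((h.bracket k).D : ℝ → ℝ) = fun x => h.D.D x * k x - h x * k.D.D x :=
      funext fun x => VectS1.D_bracket h k x
    have e1 : (h.bracket k).D.D x = deriv (fun x => h.D.D x * k x - h x * k.D.D x) x := by
      rw [← e2]; rfl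
    rw [e1]
    refine hd.deriv.trans ?_
    ring
  -- the difference of the integrands is the derivative of a periodic function
  let P : ℝ → ℝ := fun x => h.D x * (k.D.D x * l x - k x * l.D.D x)
    - k.D x * (h.D.D x * l x - h x * l.D.D x)
  have hP : ∀ x ∈ uIcc (0 : ℝ) (2 * π), HasDerivAt P (h.D x * (k.bracket l).D.D x
      - ((h.bracket k).D x * l.D.D x + k.D x * (h.bracket l).D.D x)) x := fun x _ => by
    have := ((h.D.hasDerivAt x).mul (((k.D.D.hasDerivAt x).mul (l.hasDerivAt x)).sub
      ((k.hasDerivAt x).mul (l.D.D.hasDerivAt x)))).sub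
      ((k.D.hasDerivAt x).mul (((h.D.D.hasDerivAt x).mul (l.hasDerivAt x)).sub
      ((h.hasDerivAt x).mul (l.D.D.hasDerivAt x))))
    refine this.congr_deriv ?_
    simp only [e, VectS1.D_bracket, Pi.mul_apply, Pi.sub_apply]
    ring
  have i1 := VectS1.intervalIntegrable_mul h.D (k.bracket l).D.D 0 (2 * π)
  have i2 := VectS1.intervalIntegrable_mul (h.bracket k).D l.D.D 0 (2 * π)
  have i3 := VectS1.intervalIntegrable_mul k.D (h.bracket l).D.D 0 (2 * π)
  have key := intervalIntegral.integral_eq_sub_of_hasDerivAt hP (i1.sub (i2.add i3))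
  have p0 : P (2 * π) = P 0 := by
    have q (f : VectS1) : f (2 * π) = f 0 := by simpa using f.periodic 0
    simp only [P, q]
  rw [p0, sub_self, intervalIntegral.integral_sub i1 (i2.add i3),
    intervalIntegral.integral_add i2 i3, sub_eq_zero] at key
  exact key

instance : LieRing VirAlg where
  add_lie X Y Z := by
    refine VirAlg.ext (fun x => ?_) ?_
    · simp; ring
    · simp [omega_add_left]
  lie_add X Y Z := by
    refine VirAlg.ext (fun x => ?_) ?_
    · simp; ring
    · simp [omega_add_right]
  lie_self X := by
    refine VirAlg.ext (fun x => ?_) ?_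
    · simp; ring
    · simp [omega_self]
  leibniz_lie X Y Z := by
    refine VirAlg.ext (fun x => ?_) ?_
    · simp; ring
    · simp only [VirAlg.snd_bracket, VirAlg.snd_add, VirAlg.fst_bracket]
      exact omega_bracket _ _ _

instance : LieAlgebra ℝ VirAlg where
  lie_smul c X Y := by
    refine VirAlg.ext (fun x => ?_) ?_
    · simp; ring
    · simp [omega_smul_right]

/-- The `L²` inner product `⟨(h, a), (k, b)⟩ = ∫ h k dx + a b`. -/
def l2Inner (X Y : VirAlg) : ℝ := (∫ x in (0 : ℝ)..(2 * π), X.1 x * Y.1 x) + X.2 * Y.2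

/-- `W = ad(X)ᵀ Y`: the value at `Y` of the adjoint of `ad(X)` for the `L²` inner product. -/
def IsAdTranspose (X Y W : VirAlg) : Prop :=
  ∀ V : VirAlg, l2Inner (LieAlgebra.ad ℝ VirAlg X V) Y = l2Inner V W

/-! ### The group `Diff⁺(S¹)` -/

/-- `f : ℝ → ℝ` is a smooth lift, with positive derivative, of the map `φ : S¹ → S¹`. -/
structure IsLift (f : ℝ → ℝ) (φ : Real.Angle → Real.Angle) : Prop where
  contDiff : ContDiff ℝ ∞ f
  deriv_pos : ∀ x, 0 < deriv f x
  apply_coe : ∀ x : ℝ, φ (x : Real.Angle) = (f x : Real.Angle)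

namespace IsLift

variable {f g : ℝ → ℝ} {φ : Equiv.Perm Real.Angle}

theorem differentiable {φ : Real.Angle → Real.Angle} (hf : IsLift f φ) : Differentiable ℝ f :=
  hf.contDiff.differentiable (by simp)

theorem hasDerivAt {φ : Real.Angle → Real.Angle} (hf : IsLift f φ) (x : ℝ) :
    HasDerivAt f (deriv f x) x := (hf.differentiable x).hasDerivAt

theorem strictMono {φ : Real.Angle → Real.Angle} (hf : IsLift f φ) : StrictMono f :=
  strictMono_of_deriv_pos hf.deriv_pos

theorem comp {φ ψ : Real.Angle → Real.Angle} (hf : IsLift f φ) (hg : IsLift g ψ) :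
    IsLift (f ∘ g) (φ ∘ ψ) where
  contDiff := hf.contDiff.comp hg.contDiff
  deriv_pos x := by
    rw [((hf.hasDerivAt (g x)).comp x (hg.hasDerivAt x)).deriv]
    exact mul_pos (hf.deriv_pos _) (hg.deriv_pos _)
  apply_coe x := by simp [hg.apply_coe, hf.apply_coe]

theorem id : IsLift _root_.id (_root_.id : Real.Angle → Real.Angle) where
  contDiff := contDiff_id
  deriv_pos x := by simp
  apply_coe x := rfl

/-- A lift of a bijection of the circle advances by exactly one turn. -/
theorem add_two_pi (hf : IsLift f φ) (x : ℝ) : f (x + 2 * π) = f x + 2 * π := by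
  have hc : Continuous f := hf.contDiff.continuous
  have hpi := Real.pi_pos
  have e : ((f (x + 2 * π) : ℝ) : Real.Angle) = (f x : ℝ) := by
    rw [← hf.apply_coe, ← hf.apply_coe]; simp
  obtain ⟨n, hn⟩ := Real.Angle.angle_eq_iff_two_pi_dvd_sub.1 e
  have hlt : f x < f (x + 2 * π) := hf.strictMono (by linarith)
  have hn1 : (1 : ℤ) ≤ n := by
    by_contra hcon
    have : (n : ℝ) ≤ 0 := by exact_mod_cast (by omega : n ≤ 0)
    nlinarith
  have hn1' : (1 : ℝ) ≤ n := by exact_mod_cast hn1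
  obtain ⟨y, hy, hfy⟩ := intermediate_value_Icc (by linarith : x ≤ x + 2 * π) hc.continuousOn
    (show f x + 2 * π ∈ Icc (f x) (f (x + 2 * π)) from ⟨by linarith, by nlinarith⟩)
  have ey : (y : Real.Angle) = x := by
    apply φ.injective
    rw [hf.apply_coe, hf.apply_coe, hfy]; simp
  obtain ⟨m, hm⟩ := Real.Angle.angle_eq_iff_two_pi_dvd_sub.1 ey
  have hxy : x < y := by
    rcases hy.1.lt_or_eq with h | h
    · exact h
    · subst h; linarith
  have hm1 : (1 : ℝ) ≤ m := by
    have : (1 : ℤ) ≤ m := by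
      by_contra hcon
      have : (m : ℝ) ≤ 0 := by exact_mod_cast (by omega : m ≤ 0)
      nlinarith
    exact_mod_cast this
  have : y = x + 2 * π := le_antisymm hy.2 (by nlinarith)
  rw [← this, hfy]

theorem surjective (hf : IsLift f φ) : Function.Surjective f := by
  have hpi := Real.pi_pos
  have hc : Continuous f := hf.contDiff.continuous
  have hn (n : ℕ) : f (n * (2 * π)) = f 0 + n * (2 * π) := by
    induction n with
    | zero => simp
    | succ n ih =>
      have := hf.add_two_pi (n * (2 * π))
      rw [ih] at this
      push_cast
      rw [add_mul, one_mul, this]; ring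
  have hn' (n : ℕ) : f (-(n * (2 * π))) = f 0 - n * (2 * π) := by
    induction n with
    | zero => simp
    | succ n ih =>
      have := hf.add_two_pi (-((n + 1 : ℕ) * (2 * π)))
      have e : -(((n + 1 : ℕ) : ℝ) * (2 * π)) + 2 * π = -(n * (2 * π)) := by push_cast; ring
      rw [e, ih] at this
      push_cast at this ⊢
      linarith
  intro y
  obtain ⟨n, hyn⟩ := exists_nat_gt (|y - f 0| / (2 * π))
  rw [div_lt_iff₀ (by positivity)] at hyn
  have h1 := abs_lt.1 hyn
  have h0 : (0 : ℝ) ≤ n * (2 * π) := by positivity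
  obtain ⟨x, -, hx⟩ := intermediate_value_Icc
    (by linarith : -((n : ℝ) * (2 * π)) ≤ n * (2 * π)) hc.continuousOn
    (show y ∈ Icc (f (-(n * (2 * π)))) (f (n * (2 * π))) by
      rw [hn, hn']; constructor <;> linarith)
  exact ⟨x, hx⟩

theorem inv (hf : IsLift f φ) : ∃ g, IsLift g (φ⁻¹ : Equiv.Perm Real.Angle) := by
  let e : ℝ ≃o ℝ := StrictMono.orderIsoOfSurjective f hf.strictMono hf.surjective
  let h : ℝ ≃ₜ ℝ := e.toHomeomorph
  have hh : (h : ℝ → ℝ) = f := rfl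
  have hd : ∀ x, HasDerivAt h (deriv f x) x := fun x => hf.hasDerivAt x
  refine ⟨h.symm, h.contDiff_symm_deriv (fun x => (hf.deriv_pos x).ne') hd hf.contDiff, ?_, ?_⟩
  · intro y
    have := (hd (h.symm y)).of_local_left_inverse h.symm.continuous.continuousAt
      (hf.deriv_pos _).ne' (Filter.Eventually.of_forall h.apply_symm_apply)
    rw [this.deriv]
    exact inv_pos.2 (hf.deriv_pos _)
  · intro y
    rw [Equiv.Perm.inv_eq_iff_eq, hf.apply_coe, ← hh, h.apply_symm_apply]

theorem deriv_periodic (hf : IsLift f φ) : Function.Periodic (deriv f) (2 * π) := by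
  intro x
  rw [← deriv_comp_add_const]
  have : (fun y => f (y + 2 * π)) = fun y => f y + 2 * π := funext hf.add_two_pi
  rw [this, deriv_add_const]

theorem periodic_apply_eq {F : ℝ → ℝ} (hF : Function.Periodic F (2 * π)) {x y : ℝ}
    (h : (x : Real.Angle) = y) : F x = F y := by
  obtain ⟨n, hn⟩ := Real.Angle.angle_eq_iff_two_pi_dvd_sub.1 h
  have : x = y + n * (2 * π) := by linarith
  rw [this]
  exact hF.int_mul n y

/-- Two lifts have the same derivative. -/
theorem deriv_eq {φ : Real.Angle → Real.Angle} (hf : IsLift f φ) (hg : IsLift g φ) :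
    deriv f = deriv g := by
  have hmaps : MapsTo (fun x => f x - g x) univ (AddSubgroup.zmultiples (2 * π) : Set ℝ) := by
    intro x _
    obtain ⟨n, hn⟩ := Real.Angle.angle_eq_iff_two_pi_dvd_sub.1
      ((hf.apply_coe x).symm.trans (hg.apply_coe x))
    refine ⟨n, ?_⟩
    simp only [zsmul_eq_mul]
    linarith
  have hconst : ∀ x, f x - g x = f 0 - g 0 := fun x =>
    isPreconnected_univ.constant_of_mapsTo
      (T := (AddSubgroup.zmultiples (2 * π) : Set ℝ)) (by
        have : DiscreteTopology (AddSubgroup.zmultiples (2 * π)) := inferInstance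
        exact ⟨this⟩)
      (hf.contDiff.continuous.sub hg.contDiff.continuous).continuousOn hmaps
      (mem_univ x) (mem_univ 0)
  have : f = fun x => g x + (f 0 - g 0) := funext fun x => by linarith [hconst x]
  rw [this]
  funext x
  rw [deriv_add_const]

end IsLift

/-- The bijections of the circle `S¹ = ℝ / 2πℤ` that have a smooth lift `ℝ → ℝ` with positive
derivative. -/
def diffPlusSubgroup : Subgroup (Equiv.Perm Real.Angle) where
  carrier := {φ | ∃ f : ℝ → ℝ, IsLift f φ}
  mul_mem' := by
    rintro φ ψ ⟨f, hf⟩ ⟨g, hg⟩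
    exact ⟨f ∘ g, hf.comp hg⟩
  one_mem' := ⟨id, IsLift.id⟩
  inv_mem' := by
    rintro φ ⟨f, hf⟩
    exact hf.inv

/-- `Diff⁺(S¹)`, the group of orientation preserving smooth diffeomorphisms of the circle. -/
def DiffPlus : Type := diffPlusSubgroup

instance : Group DiffPlus := inferInstanceAs (Group diffPlusSubgroup)

instance : CoeFun DiffPlus (fun _ => Real.Angle → Real.Angle) := ⟨fun φ => φ.1⟩

namespace DiffPlus

/-- A lift of `φ` (unique up to an additive constant in `2πℤ`). -/
def lift (φ : DiffPlus) : ℝ → ℝ := φ.2.choose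

theorem isLift (φ : DiffPlus) : IsLift φ.lift φ.1 := φ.2.choose_spec

/-- `φ' : S¹ → ℝ⁺`, as a `2π`-periodic function. -/
def jac (φ : DiffPlus) : ℝ → ℝ := deriv φ.lift

theorem jac_eq {φ : DiffPlus} {f : ℝ → ℝ} (hf : IsLift f φ.1) : φ.jac = deriv f :=
  φ.isLift.deriv_eq hf

theorem jac_pos (φ : DiffPlus) (x : ℝ) : 0 < φ.jac x := φ.isLift.deriv_pos x

theorem jac_periodic (φ : DiffPlus) : Function.Periodic φ.jac (2 * π) := φ.isLift.deriv_periodic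

theorem jac_contDiff (φ : DiffPlus) : ContDiff ℝ ∞ φ.jac := contDiff_deriv φ.isLift.contDiff

/-- `log φ'`. -/
def logJac (φ : DiffPlus) (x : ℝ) : ℝ := Real.log (φ.jac x)

theorem logJac_periodic (φ : DiffPlus) : Function.Periodic φ.logJac (2 * π) := fun x => by
  simp only [logJac, φ.jac_periodic x]

theorem logJac_contDiff (φ : DiffPlus) : ContDiff ℝ ∞ φ.logJac :=
  φ.jac_contDiff.log fun x => (φ.jac_pos x).ne'

theorem logJac_hasDerivAt (φ : DiffPlus) (x : ℝ) :
    HasDerivAt φ.logJac (deriv φ.logJac x) x :=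
  (φ.logJac_contDiff.differentiable (by simp) x).hasDerivAt

theorem logJac_mul (φ ψ : DiffPlus) (x : ℝ) :
    (φ * ψ).logJac x = φ.logJac (ψ.lift x) + ψ.logJac x := by
  have h : IsLift (φ.lift ∘ ψ.lift) (φ * ψ : DiffPlus).1 := φ.isLift.comp ψ.isLift
  unfold logJac
  rw [jac_eq h, ((φ.isLift.hasDerivAt (ψ.lift x)).comp x (ψ.isLift.hasDerivAt x)).deriv]
  exact Real.log_mul (φ.jac_pos _).ne' (ψ.jac_pos _).ne'

theorem logJac_one (x : ℝ) : (1 : DiffPlus).logJac x = 0 := by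
  have h : IsLift id (1 : DiffPlus).1 := IsLift.id
  unfold logJac
  rw [jac_eq h]; simp

theorem coe_lift_mul (φ ψ : DiffPlus) (x : ℝ) :
    (((φ * ψ).lift x : ℝ) : Real.Angle) = (φ.lift (ψ.lift x) : ℝ) := by
  rw [← (φ * ψ).isLift.apply_coe, ← φ.isLift.apply_coe, ← ψ.isLift.apply_coe]
  rfl

theorem lift_two_pi (φ : DiffPlus) : φ.lift (2 * π) = φ.lift 0 + 2 * π := by
  simpa using φ.isLift.add_two_pi 0

end DiffPlus

/-- The Bott cocycle `c(φ, ψ) = ∫ log(φ' ∘ ψ) d log ψ'`. -/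
def bott (φ ψ : DiffPlus) : ℝ :=
  ∫ x in (0 : ℝ)..(2 * π), φ.logJac (ψ.lift x) * deriv ψ.logJac x

theorem bott_one_left (ψ : DiffPlus) : bott 1 ψ = 0 := by simp [bott, DiffPlus.logJac_one]

theorem bott_one_right (φ : DiffPlus) : bott φ 1 = 0 := by
  have : (1 : DiffPlus).logJac = fun _ => 0 := funext DiffPlus.logJac_one
  simp [bott, this]

theorem integral_periodic_deriv_self {F : ℝ → ℝ} (hF : ContDiff ℝ ∞ F)
    (hp : Function.Periodic F (2 * π)) : ∫ x in (0 : ℝ)..(2 * π), F x * deriv F x = 0 := by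
  have hd : ∀ x ∈ uIcc (0 : ℝ) (2 * π), HasDerivAt (fun x => F x ^ 2 / 2) (F x * deriv F x) x :=
    fun x _ => by
      convert! (((hF.differentiable (by simp) x).hasDerivAt).pow 2).div_const 2 using 1
      simp; ring
  rw [intervalIntegral.integral_eq_sub_of_hasDerivAt hd
    ((hF.continuous.mul (contDiff_deriv hF).continuous).intervalIntegrable _ _)]
  have := hp 0
  simp only [zero_add] at this
  rw [this, sub_self]

theorem bott_inv_left (φ : DiffPlus) : bott φ⁻¹ φ = 0 := by
  have h : ∀ x, φ⁻¹.logJac (φ.lift x) = -φ.logJac x := fun x => by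
    have h1 := DiffPlus.logJac_mul φ⁻¹ φ x
    rw [inv_mul_cancel, DiffPlus.logJac_one] at h1
    linarith
  simp [bott, h, integral_periodic_deriv_self φ.logJac_contDiff φ.logJac_periodic]

theorem bott_cocycle (φ ψ χ : DiffPlus) :
    bott φ ψ + bott (φ * ψ) χ = bott ψ χ + bott φ (ψ * χ) := by
  have cl (φ : DiffPlus) : Continuous φ.logJac := φ.logJac_contDiff.continuous
  have cd (φ : DiffPlus) : Continuous (deriv φ.logJac) :=
    (contDiff_deriv φ.logJac_contDiff).continuous
  have ct (φ : DiffPlus) : Continuous φ.lift := φ.isLift.contDiff.continuous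
  -- change of variables `x ↦ χ x` in the first integral
  have hG : Function.Periodic (fun x => φ.logJac (ψ.lift x) * deriv ψ.logJac x) (2 * π) := by
    intro x
    have h1 : φ.logJac (ψ.lift (x + 2 * π)) = φ.logJac (ψ.lift x) := by
      rw [ψ.isLift.add_two_pi, φ.logJac_periodic]
    simp only [h1, periodic_deriv ψ.logJac_periodic x]
  have h1 : bott φ ψ = ∫ x in (0 : ℝ)..(2 * π),
      φ.logJac (ψ.lift (χ.lift x)) * deriv ψ.logJac (χ.lift x) * deriv χ.lift x := by
    have := intervalIntegral.integral_comp_mul_deriv (a := 0) (b := 2 * π) (f := χ.lift)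
      (f' := deriv χ.lift) (g := fun x => φ.logJac (ψ.lift x) * deriv ψ.logJac x)
      (fun x _ => χ.isLift.hasDerivAt x)
      (contDiff_deriv χ.isLift.contDiff).continuous.continuousOn
      (((cl φ).comp (ct ψ)).mul (cd ψ))
    simp only [Function.comp_def] at this
    rw [this, χ.lift_two_pi, hG.intervalIntegral_add_eq (χ.lift 0) 0, zero_add]
    rfl
  have h2 : bott φ (ψ * χ) = ∫ x in (0 : ℝ)..(2 * π),
      φ.logJac (ψ.lift (χ.lift x)) * (deriv ψ.logJac (χ.lift x) * deriv χ.lift x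
        + deriv χ.logJac x) := by
    unfold bott
    congr 1
    funext x
    have e1 := IsLift.periodic_apply_eq φ.logJac_periodic (DiffPlus.coe_lift_mul ψ χ x)
    have e2 : (ψ * χ).logJac = fun x => ψ.logJac (χ.lift x) + χ.logJac x :=
      funext (DiffPlus.logJac_mul ψ χ)
    have e3 := (((ψ.logJac_hasDerivAt (χ.lift x)).comp x (χ.isLift.hasDerivAt x)).add
      (χ.logJac_hasDerivAt x)).deriv
    rw [e1, e2]
    congr 1
  have h3 : bott (φ * ψ) χ = ∫ x in (0 : ℝ)..(2 * π),
      (φ.logJac (ψ.lift (χ.lift x)) + ψ.logJac (χ.lift x)) * deriv χ.logJac x := by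
    unfold bott
    congr 1
    funext x
    rw [DiffPlus.logJac_mul]
  have c1 := (cl φ).comp ((ct ψ).comp (ct χ))
  have c2 := (cl ψ).comp (ct χ)
  have c3 := (cd ψ).comp (ct χ)
  have c4 : Continuous (deriv χ.lift) := (contDiff_deriv χ.isLift.contDiff).continuous
  simp only [Function.comp_def] at c1 c2 c3
  rw [h1, h2, h3]
  unfold bott
  rw [← intervalIntegral.integral_add, ← intervalIntegral.integral_add]
  · congr 1
    funext x
    ring
  · exact (c2.mul (cd χ)).intervalIntegrable _ _
  · exact (c1.mul ((c3.mul c4).add (cd χ))).intervalIntegrable _ _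
  · exact ((c1.mul c3).mul c4).intervalIntegrable _ _
  · exact ((c1.add c2).mul (cd χ)).intervalIntegrable _ _

/-! ### The Virasoro–Bott group -/

/-- The Virasoro–Bott group `S¹ ×_c Diff⁺(S¹)`. -/
@[ext] structure VBGroup where
  diff : DiffPlus
  circ : Circle

namespace VBGroup

/-- `(φ, α) (ψ, β) = (φ ∘ ψ, α β e^{2πi c(φ, ψ)})` -/
instance : Mul VBGroup :=
  ⟨fun g h => ⟨g.diff * h.diff, g.circ * h.circ * Circle.exp (2 * π * bott g.diff h.diff)⟩⟩

instance : One VBGroup := ⟨⟨1, 1⟩⟩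

/-- `(φ, α)⁻¹ = (φ⁻¹, α⁻¹)` -/
instance : Inv VBGroup := ⟨fun g => ⟨g.diff⁻¹, g.circ⁻¹⟩⟩

@[simp] theorem mul_diff (g h : VBGroup) : (g * h).diff = g.diff * h.diff := rfl
@[simp] theorem mul_circ (g h : VBGroup) :
    (g * h).circ = g.circ * h.circ * Circle.exp (2 * π * bott g.diff h.diff) := rfl
@[simp] theorem one_diff : (1 : VBGroup).diff = 1 := rfl
@[simp] theorem one_circ : (1 : VBGroup).circ = 1 := rfl
@[simp] theorem inv_diff (g : VBGroup) : g⁻¹.diff = g.diff⁻¹ := rfl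
@[simp] theorem inv_circ (g : VBGroup) : g⁻¹.circ = g.circ⁻¹ := rfl

instance : Group VBGroup where
  mul_assoc g h k := by
    refine VBGroup.ext (mul_assoc _ _ _) ?_
    have e : Circle.exp (2 * π * bott g.diff h.diff)
          * Circle.exp (2 * π * bott (g.diff * h.diff) k.diff)
        = Circle.exp (2 * π * bott h.diff k.diff)
          * Circle.exp (2 * π * bott g.diff (h.diff * k.diff)) := by
      rw [← Circle.exp_add, ← Circle.exp_add, ← mul_add, ← mul_add, bott_cocycle]
    simp only [mul_circ, mul_diff]
    generalize Circle.exp (2 * π * bott g.diff h.diff) = A at *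
    generalize Circle.exp (2 * π * bott (g.diff * h.diff) k.diff) = B at *
    generalize Circle.exp (2 * π * bott h.diff k.diff) = C at *
    generalize Circle.exp (2 * π * bott g.diff (h.diff * k.diff)) = D at *
    calc g.circ * h.circ * A * k.circ * B = g.circ * (h.circ * k.circ) * (A * B) := by
          simp only [mul_comm, mul_left_comm]
      _ = g.circ * (h.circ * k.circ * C) * D := by
          rw [e]; simp only [mul_assoc]
  one_mul g := VBGroup.ext (one_mul _) (by simp [bott_one_left])
  mul_one g := VBGroup.ext (mul_one _) (by simp [bott_one_right])
  inv_mul_cancel g := VBGroup.ext (inv_mul_cancel _) (by simp [bott_inv_left])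

end VBGroup

/-- Smoothness on an open set `W` of a family `Γ : P → VBGroup` with parameters in a normed space
`P`: the family of diffeomorphisms and the circle component have smooth lifts
`F : W × ℝ → ℝ` and `θ : W → ℝ`. It is used for `W` an open set of the line or a product of two
such sets, where smooth maps to the circle always have smooth lifts. -/
def IsSmoothOn {P : Type} [NormedAddCommGroup P] [NormedSpace ℝ P] (Γ : P → VBGroup)
    (W : Set P) : Prop :=
  ∃ (F : P × ℝ → ℝ) (θ : P → ℝ), ContDiffOn ℝ ∞ F (W ×ˢ univ) ∧ ContDiffOn ℝ ∞ θ W ∧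
    ∀ p ∈ W, (∀ x : ℝ, (Γ p).diff (x : Real.Angle) = (F (p, x) : Real.Angle)) ∧
      (Γ p).circ = Circle.exp (θ p)

/-- `X` is the right trivialized velocity `κ(γ'(t)) = T(μ^{γ(t)⁻¹}) γ'(t)` of the curve `γ` at time
`t`, that is the velocity at `τ = t` of `τ ↦ γ(τ) γ(t)⁻¹`, which passes through the unit at `τ = t`.
The tangent space of `Diff⁺(S¹)` at the identity is `𝔛(S¹)`, and `a ∈ ℝ` corresponds to the tangent
vector `4πi a` of the circle at `1`; for this identification the bracket of the group is that
of `VirAlg`. -/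
def HasRightLogDeriv (γ : ℝ → VBGroup) (t : ℝ) (X : VirAlg) : Prop :=
  (∀ x : ℝ, HasDerivAt
    (fun τ => ((γ τ * (γ t)⁻¹).diff (x : Real.Angle) - (x : Real.Angle)).toReal) (X.1 x) t) ∧
  HasDerivAt (fun τ => Complex.arg ((γ τ * (γ t)⁻¹).circ : ℂ)) (4 * π * X.2) t

open Classical in
/-- The right logarithmic derivative of `γ` at time `t` (`0` if it does not exist). -/
def rightLogDeriv (γ : ℝ → VBGroup) (t : ℝ) : VirAlg :=
  if h : ∃ X, HasRightLogDeriv γ t X then h.choose else 0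

/-- The energy `½ ∫ G_γ(γ', γ') dt` of a curve for the right invariant metric
`G_g(ξ, η) = ⟨κ(ξ), κ(η)⟩`. -/
def energy (γ : ℝ → VBGroup) (a b : ℝ) : ℝ :=
  1 / 2 * ∫ t in a..b, l2Inner (rightLogDeriv γ t) (rightLogDeriv γ t)

/-- `γ` restricted to `[a, b]` is a geodesic: a critical point of the energy under all smooth
variations with fixed end points. -/
def IsGeodesicOn (γ : ℝ → VBGroup) (a b : ℝ) : Prop :=
  ∀ (J K : Set ℝ) (Γ : ℝ × ℝ → VBGroup), IsOpen J → IsOpen K → Icc a b ⊆ J → (0 : ℝ) ∈ K →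
    IsSmoothOn Γ (J ×ˢ K) → (∀ t ∈ Icc a b, Γ (t, 0) = γ t) →
    (∀ s ∈ K, Γ (a, s) = γ a ∧ Γ (b, s) = γ b) →
    HasDerivAt (fun s => energy (fun t => Γ (t, s)) a b) 0 0

end VirasoroBott

end

/-!
The computations take place in Lagrangian coordinates. A smooth family `Γ : P → VBGroup` over an
open set `W` is given by a lift `F : W × ℝ → ℝ` of its diffeomorphisms, with
`F (p, y + 2π) = F (p, y) + 2π` and `∂_y F > 0`, and by a lift `θ : W → ℝ` of its circle
component. Since the Bott cocycle satisfies `c(φ, ψ⁻¹) = -∫ log φ' d log ψ'` (`bott_inv_right`),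
with `L = log ∂_y F` the right logarithmic derivative in a direction `v` is the pair `(u, a)` with

  `u ∘ F = ∂_v F`, `a = ∂_v θ / 4π - ½ ∫ ∂_v L ∂_y L dy`

(`IsSmoothLift.hasRightLogDeriv`). The field `u` is smooth because the fibrewise inverse of `F` is,
by the inverse function theorem (`contDiffOn_fiberwise_inverse`).

*Lie bracket.* The same description gives `Ad(φ, α)(k, b)` as `(φ' k) ∘ φ⁻¹` and
`b + ½ ∫ (ℓ k'' - (ℓ' k + k') ℓ') dy` with `ℓ = log φ'` (`hasRightLogDeriv_conj`). Along a curve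
through the unit with velocity `(h, a)` one has `ℓ = 0` and `∂_t ℓ = h'` at `t = 0`, and
differentiation gives `h' k - h k'` and `½ ∫ (h' k'' - k' h'') = ω(h, k)`.

*Adjoint.* The formula for `ad(h, a)ᵀ` is an integration by parts over the circle, and uniqueness
holds because the inner product is definite.

*Geodesics.* For a variation with parameters `(t, s)` let `(u, a)` and `(w, b)` be the right
logarithmic derivatives in `t` and in `s`. Integrations by parts over the circle give

  `∂_s ½ (∫ u² dx + a²) = ∂_t (∫ u w dx + a b) - ∫ w (u_t + 3 u u_x + a u_xxx) dx - a_t b`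

(`IsSmoothLift.dirDeriv_energyDensity`, in Lagrangian coordinates; `IsSmoothLift.lagrangianKdV_eq`
translates the Korteweg–de Vries expression). As `w` and `b` vanish at fixed end points, the
integral of the total derivative in `t` is zero, and that of the other two terms is the first
variation of the energy (`IsSmoothLift.hasDerivAt_energy`). It vanishes if `a` is constant and the
equation holds (`isGeodesicOn_of_kdv`).
Conversely, let `χ = (t - t₀) (t₁ - t)`. The variation that moves only the circle component, with
`b = χ a_t`, forces `∫ χ a_t² dt = 0`, so that `a` is constant; the variation with
`w = χ (u_t + 3 u u_x + a u_xxx)` then forces the equation (`IsGeodesicOn.kdv`).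
-/

namespace VirasoroBott

open scoped Topology Interval

/-! ### Directional derivatives of smooth functions on open sets -/

section DirDeriv

variable {E : Type*} [NormedAddCommGroup E] [NormedSpace ℝ E] {U : Set E} {f g : E → ℝ} {x : E}

/-- The directional derivative `∂_v f`, as a function. -/
noncomputable def dirDeriv (v : E) (f : E → ℝ) (x : E) : ℝ := fderiv ℝ f x v

theorem differentiableAt_of_contDiffOn (hf : ContDiffOn ℝ ∞ f U) (hU : IsOpen U) (hx : x ∈ U) :
    DifferentiableAt ℝ f x :=
  (hf.contDiffAt (hU.mem_nhds hx)).differentiableAt (by simp)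

theorem contDiffOn_dirDeriv (hf : ContDiffOn ℝ ∞ f U) (hU : IsOpen U) (v : E) :
    ContDiffOn ℝ ∞ (dirDeriv v f) U :=
  ((contDiffOn_infty_iff_fderiv_of_isOpen hU).1 hf).2.clm_apply contDiffOn_const

theorem dirDeriv_congr (hU : IsOpen U) (h : EqOn f g U) (hx : x ∈ U) (v : E) :
    dirDeriv v f x = dirDeriv v g x := by
  unfold dirDeriv
  rw [(Filter.eventuallyEq_of_mem (hU.mem_nhds hx) h).fderiv_eq]

/-- Partial derivatives of a smooth function commute. -/
theorem dirDeriv_comm (hf : ContDiffOn ℝ ∞ f U) (hU : IsOpen U) (hx : x ∈ U) (v w : E) :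
    dirDeriv v (dirDeriv w f) x = dirDeriv w (dirDeriv v f) x := by
  have hs : IsSymmSndFDerivAt ℝ f x :=
    (hf.contDiffAt (hU.mem_nhds hx)).isSymmSndFDerivAt (by
      rw [minSmoothness_of_isRCLikeNormedField]
      exact ENat.LEInfty.out)
  have hd : DifferentiableAt ℝ (fderiv ℝ f) x :=
    (((contDiffOn_infty_iff_fderiv_of_isOpen hU).1 hf).2.contDiffAt
      (hU.mem_nhds hx)).differentiableAt (by simp)
  have e (v w : E) : dirDeriv v (dirDeriv w f) x = fderiv ℝ (fderiv ℝ f) x v w := by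
    change fderiv ℝ (fun y => fderiv ℝ f y w) x v = _
    rw [fderiv_clm_apply hd (differentiableAt_const w)]
    simp
  rw [e, e]
  exact hs v w

theorem dirDeriv_add (hf : DifferentiableAt ℝ f x) (hg : DifferentiableAt ℝ g x) (v : E) :
    dirDeriv v (fun y => f y + g y) x = dirDeriv v f x + dirDeriv v g x := by
  simp [dirDeriv, fderiv_fun_add hf hg]

theorem dirDeriv_sub (hf : DifferentiableAt ℝ f x) (hg : DifferentiableAt ℝ g x) (v : E) :
    dirDeriv v (fun y => f y - g y) x = dirDeriv v f x - dirDeriv v g x := by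
  simp [dirDeriv, fderiv_fun_sub hf hg]

theorem dirDeriv_mul (hf : DifferentiableAt ℝ f x) (hg : DifferentiableAt ℝ g x) (v : E) :
    dirDeriv v (fun y => f y * g y) x = dirDeriv v f x * g x + f x * dirDeriv v g x := by
  simp [dirDeriv, fderiv_fun_mul hf hg]
  ring

theorem dirDeriv_const_mul (hf : DifferentiableAt ℝ f x) (c : ℝ) (v : E) :
    dirDeriv v (fun y => c * f y) x = c * dirDeriv v f x := by
  simp [dirDeriv, fderiv_const_mul hf]

theorem dirDeriv_div_const (hf : DifferentiableAt ℝ f x) (c : ℝ) (v : E) :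
    dirDeriv v (fun y => f y / c) x = dirDeriv v f x / c := by
  simp_rw [div_eq_inv_mul]
  exact dirDeriv_const_mul hf _ v

theorem dirDeriv_pow_two (hf : DifferentiableAt ℝ f x) (v : E) :
    dirDeriv v (fun y => f y ^ 2) x = 2 * f x * dirDeriv v f x := by
  simp_rw [pow_two]
  rw [dirDeriv_mul hf hf]
  ring

theorem dirDeriv_log (hf : DifferentiableAt ℝ f x) (h0 : f x ≠ 0) (v : E) :
    dirDeriv v (fun y => Real.log (f y)) x = dirDeriv v f x / f x := by
  simp [dirDeriv, fderiv.log hf h0, div_eq_inv_mul]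

/-- The derivative of `f` along a curve. -/
theorem hasDerivAt_comp_curve {c : ℝ → E} {v : E} {t : ℝ} (hc : HasDerivAt c v t)
    (hf : DifferentiableAt ℝ f (c t)) :
    HasDerivAt (fun τ => f (c τ)) (dirDeriv v f (c t)) t :=
  hf.hasFDerivAt.comp_hasDerivAt t hc

end DirDeriv

/-! ### Integrals depending smoothly on parameters -/

section Parametric

variable {P E : Type} [NormedAddCommGroup P] [NormedSpace ℝ P]
  [NormedAddCommGroup E] [NormedSpace ℝ E] {W : Set P} {U : Set ℝ} {a b : ℝ}

theorem hasDerivAt_mk_left {P Q : Type} [NormedAddCommGroup P] [NormedSpace ℝ P]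
    [NormedAddCommGroup Q] [NormedSpace ℝ Q] {c : ℝ → P} {v : P} {t : ℝ}
    (hc : HasDerivAt c v t) (q : Q) : HasDerivAt (fun τ => (c τ, q)) (v, (0 : Q)) t :=
  hc.prodMk (hasDerivAt_const t q)

theorem hasDerivAt_mk_right {P : Type} [NormedAddCommGroup P] [NormedSpace ℝ P] (p : P) (y : ℝ) :
    HasDerivAt (fun z : ℝ => (p, z)) ((0 : P), (1 : ℝ)) y :=
  (hasDerivAt_const y p).prodMk (hasDerivAt_id y)

theorem continuousOn_slice {P E : Type} [TopologicalSpace P] [TopologicalSpace E] {W : Set P}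
    {f : P × ℝ → E} (hf : ContinuousOn f (W ×ˢ U)) {p : P} (hp : p ∈ W)
    (hab : uIcc a b ⊆ U) : ContinuousOn (fun y => f (p, y)) (uIcc a b) :=
  hf.comp (by fun_prop) fun y hy => ⟨hp, hab hy⟩

theorem hasFDerivAt_parametric_integral {f : P × ℝ → E} (hW : IsOpen W) (hU : IsOpen U)
    (hf : ContDiffOn ℝ 1 f (W ×ˢ U)) (hab : uIcc a b ⊆ U) {p : P} (hp : p ∈ W) :
    HasFDerivAt (fun q => ∫ y in a..b, f (q, y))
      (∫ y in a..b, (fderiv ℝ f (p, y)).comp (ContinuousLinearMap.inl ℝ P ℝ)) p := by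
  have hO : IsOpen (W ×ˢ U) := hW.prod hU
  have hf' : ContinuousOn (fderiv ℝ f) (W ×ˢ U) := hf.continuousOn_fderiv_of_isOpen hO le_rfl
  have hg : ContinuousOn (fun q => (fderiv ℝ f q).comp (ContinuousLinearMap.inl ℝ P ℝ))
      (W ×ˢ U) := hf'.clm_comp continuousOn_const
  obtain ⟨C, hC⟩ := isCompact_uIcc.exists_bound_of_continuousOn (continuousOn_slice hg hp hab)
  -- the derivative is bounded by `C + 1` on a tube around `{p} × [a, b]`
  have hT : IsOpen ((W ×ˢ U) ∩ {q | ‖(fderiv ℝ f q).comp (ContinuousLinearMap.inl ℝ P ℝ)‖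
      < C + 1}) := hg.norm.isOpen_inter_preimage hO isOpen_Iio
  obtain ⟨u, v, hu, -, hpu, hv, huv⟩ := generalized_tube_lemma
    (isCompact_singleton (x := p)) (isCompact_uIcc (a := a) (b := b)) hT (by
      rintro ⟨q, y⟩ ⟨rfl, hy⟩
      exact ⟨⟨hp, hab hy⟩, lt_of_le_of_lt (hC y hy) (by linarith)⟩)
  have hpu' : p ∈ u := hpu rfl
  have hIu : Ι a b ⊆ uIcc a b := uIoc_subset_uIcc
  refine intervalIntegral.hasFDerivAt_integral_of_dominated_of_fderiv_le (𝕜 := ℝ)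
    (F := fun q y => f (q, y))
    (F' := fun q y => (fderiv ℝ f (q, y)).comp (ContinuousLinearMap.inl ℝ P ℝ))
    (bound := fun _ => C + 1) (hu.mem_nhds hpu') ?_ ?_ ?_ ?_ ?_ ?_
  · filter_upwards [hW.mem_nhds hp] with q hq
    exact ((continuousOn_slice hf.continuousOn hq hab).mono hIu).aestronglyMeasurable
      measurableSet_uIoc
  · exact (continuousOn_slice hf.continuousOn hp hab).intervalIntegrable
  · exact ((continuousOn_slice hg hp hab).mono hIu).aestronglyMeasurable measurableSet_uIoc
  · exact Filter.Eventually.of_forall fun y hy q hq =>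
      (huv (Set.mk_mem_prod hq (hv (hIu hy)))).2.le
  · exact intervalIntegrable_const
  · refine Filter.Eventually.of_forall fun y hy q hq => ?_
    have hm := (huv (Set.mk_mem_prod hq (hv (hIu hy)))).1
    have hd : HasFDerivAt f (fderiv ℝ f (q, y)) (q, y) :=
      ((hf.contDiffAt (hO.mem_nhds hm)).differentiableAt (by simp)).hasFDerivAt
    exact hd.comp q (hasFDerivAt_prodMk_left q y)

theorem contDiffOn_parametric_integral_nat (n : ℕ) (hW : IsOpen W) (hU : IsOpen U)
    (hab : uIcc a b ⊆ U) : ∀ {E : Type} [NormedAddCommGroup E] [NormedSpace ℝ E] {f : P × ℝ → E},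
    ContDiffOn ℝ ∞ f (W ×ˢ U) → ContDiffOn ℝ n (fun q => ∫ y in a..b, f (q, y)) W := by
  induction n with
  | zero =>
    intro E _ _ f hf
    refine contDiffOn_zero.2 fun p hp => ContinuousAt.continuousWithinAt ?_
    exact (hasFDerivAt_parametric_integral hW hU (hf.of_le (by simp)) hab hp).continuousAt
  | succ n ih =>
    intro E _ _ f hf
    have hO : IsOpen (W ×ˢ U) := hW.prod hU
    have hd := fun p (hp : p ∈ W) =>
      hasFDerivAt_parametric_integral hW hU (hf.of_le (by simp)) hab hp
    push_cast
    refine (contDiffOn_succ_iff_fderiv_of_isOpen hW).2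
      ⟨fun p hp => (hd p hp).differentiableAt.differentiableWithinAt, by simp, ?_⟩
    refine (ih (f := fun q => (fderiv ℝ f q).comp (ContinuousLinearMap.inl ℝ P ℝ)) ?_).congr
      fun p hp => (hd p hp).fderiv
    exact ((contDiffOn_infty_iff_fderiv_of_isOpen hO).1 hf).2.clm_comp contDiffOn_const

theorem contDiffOn_parametric_integral {f : P × ℝ → E} (hW : IsOpen W) (hU : IsOpen U)
    (hf : ContDiffOn ℝ ∞ f (W ×ˢ U)) (hab : uIcc a b ⊆ U) :
    ContDiffOn ℝ ∞ (fun q => ∫ y in a..b, f (q, y)) W :=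
  contDiffOn_infty.2 fun n => contDiffOn_parametric_integral_nat n hW hU hab hf

theorem dirDeriv_parametric_integral {f : P × ℝ → ℝ} (hW : IsOpen W) (hU : IsOpen U)
    (hf : ContDiffOn ℝ ∞ f (W ×ˢ U)) (hab : uIcc a b ⊆ U) {p : P} (hp : p ∈ W) (v : P) :
    dirDeriv v (fun q => ∫ y in a..b, f (q, y)) p = ∫ y in a..b, dirDeriv (v, 0) f (p, y) := by
  unfold dirDeriv
  rw [(hasFDerivAt_parametric_integral hW hU (hf.of_le (by simp)) hab hp).fderiv,
    ContinuousLinearMap.intervalIntegral_apply]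
  · rfl
  · have hf' : ContinuousOn (fderiv ℝ f) (W ×ˢ U) :=
      hf.continuousOn_fderiv_of_isOpen (hW.prod hU) (by simp)
    have hg : ContinuousOn (fun q => (fderiv ℝ f q).comp (ContinuousLinearMap.inl ℝ P ℝ))
        (W ×ˢ U) := hf'.clm_comp continuousOn_const
    exact (continuousOn_slice hg hp hab).intervalIntegrable

/-- The integral of a derivative of a function with equal values at the end points. -/
theorem integral_dirDeriv_eq_zero {f : P × ℝ → ℝ} (hW : IsOpen W)
    (hf : ContDiffOn ℝ ∞ f (W ×ˢ univ)) {p : P} (hp : p ∈ W) (h : f (p, b) = f (p, a)) :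
    ∫ y in a..b, dirDeriv (0, 1) f (p, y) = 0 := by
  have hO : IsOpen (W ×ˢ (univ : Set ℝ)) := hW.prod isOpen_univ
  rw [intervalIntegral.integral_eq_sub_of_hasDerivAt (f := fun y => f (p, y)), h, sub_self]
  · exact fun y _ => hasDerivAt_comp_curve (hasDerivAt_mk_right p y)
      (differentiableAt_of_contDiffOn hf hO ⟨hp, mem_univ _⟩)
  · exact (continuousOn_slice (contDiffOn_dirDeriv hf hO _).continuousOn hp
      (subset_univ _)).intervalIntegrable

end Parametric

/-! ### Inverses of families of diffeomorphisms of the line -/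

section Inverse

variable {P : Type} [NormedAddCommGroup P] [NormedSpace ℝ P] {W : Set P}

/-- The fibrewise inverse of a smooth family of functions with nonzero derivatives is smooth, by
the inverse function theorem for `(p, y) ↦ (p, F (p, y))`. -/
theorem contDiffOn_fiberwise_inverse [CompleteSpace P] {F Ψ : P × ℝ → ℝ} (hW : IsOpen W)
    (hF : ContDiffOn ℝ ∞ F (W ×ˢ univ))
    (hd : ∀ p ∈ W, ∀ y, dirDeriv (0, 1) F (p, y) ≠ 0)
    (hl : ∀ p ∈ W, ∀ y, Ψ (p, F (p, y)) = y) (hr : ∀ p ∈ W, ∀ x, F (p, Ψ (p, x)) = x) :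
    ContDiffOn ℝ ∞ Ψ (W ×ˢ univ) := by
  have hO : IsOpen (W ×ˢ (univ : Set ℝ)) := hW.prod isOpen_univ
  rintro ⟨p, x⟩ ⟨hp, -⟩
  refine ContDiffAt.contDiffWithinAt ?_
  set q : P × ℝ := (p, Ψ (p, x)) with hq
  have hqW : q ∈ W ×ˢ (univ : Set ℝ) := ⟨hp, mem_univ _⟩
  set Φ : P × ℝ → P × ℝ := fun z => (z.1, F z) with hΦ
  have hFq : ContDiffAt ℝ ∞ F q := hF.contDiffAt (hO.mem_nhds hqW)
  have hΦq : ContDiffAt ℝ ∞ Φ q := contDiffAt_fst.prodMk hFq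
  set A : P × ℝ →L[ℝ] ℝ := fderiv ℝ F q with hA
  have hA0 : A (0, 1) ≠ 0 := hd p hp _
  have hsplit (v : P) (r : ℝ) : A (v, r) = A (v, 0) + r * A (0, 1) := by
    have : ((v, r) : P × ℝ) = (v, 0) + r • ((0 : P), (1 : ℝ)) := by simp
    rw [this, map_add, map_smul, smul_eq_mul]
  let e : (P × ℝ) ≃L[ℝ] (P × ℝ) := ContinuousLinearEquiv.equivOfInverse
    ((ContinuousLinearMap.fst ℝ P ℝ).prod A)
    ((ContinuousLinearMap.fst ℝ P ℝ).prod ((A (0, 1))⁻¹ • (ContinuousLinearMap.snd ℝ P ℝ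
      - A.comp ((ContinuousLinearMap.inl ℝ P ℝ).comp (ContinuousLinearMap.fst ℝ P ℝ)))))
    (by
      rintro ⟨v, r⟩
      simp only [ContinuousLinearMap.prod_apply, ContinuousLinearMap.coe_fst',
        smul_apply, sub_apply, ContinuousLinearMap.coe_snd',
        ContinuousLinearMap.comp_apply, ContinuousLinearMap.inl_apply, smul_eq_mul, Prod.mk.injEq,
        true_and]
      rw [hsplit v r]
      field_simp
      ring)
    (by
      rintro ⟨v, r⟩
      simp only [ContinuousLinearMap.prod_apply, ContinuousLinearMap.coe_fst',
        smul_apply, sub_apply, ContinuousLinearMap.coe_snd',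
        ContinuousLinearMap.comp_apply, ContinuousLinearMap.inl_apply, smul_eq_mul, Prod.mk.injEq,
        true_and]
      rw [hsplit v]
      field_simp
      ring)
  have he : HasFDerivAt Φ (e : P × ℝ →L[ℝ] P × ℝ) q :=
    hasFDerivAt_fst.prodMk (hFq.differentiableAt (by simp)).hasFDerivAt
  have hs := hΦq.hasStrictFDerivAt' he (by simp)
  have hinv := hΦq.to_localInverse he (by simp)
  have huniq := hs.localInverse_unique (g := fun z => (z.1, Ψ z)) (by
    filter_upwards [hO.mem_nhds hqW] with z hz
    ext
    · rfl
    · exact hl z.1 hz.1 z.2)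
  have hΦqe : Φ q = (p, x) := Prod.ext rfl (hr p hp x)
  rw [hΦqe] at hinv huniq
  exact (hinv.congr_of_eventuallyEq huniq).snd

end Inverse

/-! ### Circle-valued functions and lifts -/

theorem hasDerivAt_toReal_coe {f : ℝ → ℝ} {f' t : ℝ} (hf : HasDerivAt f f' t)
    (h0 : ((f t : ℝ) : Real.Angle) = 0) :
    HasDerivAt (fun τ => ((f τ : ℝ) : Real.Angle).toReal) f' t := by
  refine (hf.sub_const (f t)).congr_of_eventuallyEq ?_
  have hc : Filter.Tendsto (fun τ => f τ - f t) (𝓝 t) (𝓝 0) := by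
    simpa using hf.continuousAt.tendsto.sub_const (f t)
  filter_upwards [hc.eventually (Ioo_mem_nhds (neg_lt_zero.2 pi_pos) pi_pos)] with τ hτ
  have e : ((f τ : ℝ) : Real.Angle) = ((f τ - f t : ℝ) : Real.Angle) := by simp [h0]
  rw [e]
  exact Real.Angle.toReal_coe_eq_self_iff.2 ⟨hτ.1, hτ.2.le⟩

theorem hasDerivAt_arg_exp {f : ℝ → ℝ} {f' t : ℝ} (hf : HasDerivAt f f' t)
    (h0 : Circle.exp (f t) = 1) :
    HasDerivAt (fun τ => Complex.arg (Circle.exp (f τ) : ℂ)) f' t := by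
  refine (hf.sub_const (f t)).congr_of_eventuallyEq ?_
  have hc : Filter.Tendsto (fun τ => f τ - f t) (𝓝 t) (𝓝 0) := by
    simpa using hf.continuousAt.tendsto.sub_const (f t)
  filter_upwards [hc.eventually (Ioo_mem_nhds (neg_lt_zero.2 pi_pos) pi_pos)] with τ hτ
  have e : Circle.exp (f τ) = Circle.exp (f τ - f t) := by rw [Circle.exp_sub, h0, div_one]
  rw [e]
  exact Circle.arg_exp hτ.1 hτ.2.le

/-- Two continuous lifts of the same map to the circle differ by a constant. -/
theorem sub_eq_of_coe_eq {f g : ℝ → ℝ} (hf : Continuous f) (hg : Continuous g)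
    (h : ∀ x, ((f x : ℝ) : Real.Angle) = g x) (x : ℝ) : f x - g x = f 0 - g 0 := by
  have hmaps : MapsTo (fun x => f x - g x) univ (AddSubgroup.zmultiples (2 * π) : Set ℝ) := by
    intro x _
    obtain ⟨n, hn⟩ := Real.Angle.angle_eq_iff_two_pi_dvd_sub.1 (h x)
    refine ⟨n, ?_⟩
    simp only [zsmul_eq_mul]
    linarith
  exact isPreconnected_univ.constant_of_mapsTo
    (T := (AddSubgroup.zmultiples (2 * π) : Set ℝ)) (by
      have : DiscreteTopology (AddSubgroup.zmultiples (2 * π)) := inferInstance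
      exact ⟨this⟩)
    (hf.sub hg).continuousOn hmaps (mem_univ x) (mem_univ 0)

namespace DiffPlus

theorem ext_of_coe {φ ψ : DiffPlus} (h : ∀ x : ℝ, φ (x : Real.Angle) = ψ (x : Real.Angle)) :
    φ = ψ := by
  refine Subtype.ext (Equiv.ext fun a => ?_)
  induction a using Real.Angle.induction_on with
  | _ x => exact h x

theorem coe_mul_apply (φ ψ : DiffPlus) (a : Real.Angle) : (φ * ψ) a = φ (ψ a) := rfl

theorem inv_apply_eq {φ : DiffPlus} {a b : Real.Angle} (h : φ b = a) : φ⁻¹ a = b :=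
  Equiv.Perm.inv_eq_iff_eq.2 h.symm

/-- A smooth `f` with positive derivative and `f (x + 2π) = f x + 2π` is the lift of a
diffeomorphism of the circle. -/
theorem exists_isLift {f : ℝ → ℝ} (hf : ContDiff ℝ ∞ f) (hd : ∀ x, 0 < deriv f x)
    (hp : ∀ x, f (x + 2 * π) = f x + 2 * π) : ∃ φ : DiffPlus, IsLift f φ.1 := by
  have hpi := Real.pi_pos
  have hmono : StrictMono f := strictMono_of_deriv_pos hd
  have hper : Function.Periodic (fun x => f x - x) (2 * π) := fun x => by
    simp only [hp]; ring
  have hint (x : ℝ) (n : ℤ) : f (x + n * (2 * π)) = f x + n * (2 * π) := by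
    have := hper.int_mul n x
    linarith
  have hP : Function.Periodic (fun x => ((f x : ℝ) : Real.Angle)) (2 * π) := fun x => by
    simp [hp]
  have hsurj : Function.Surjective f := by
    intro y
    obtain ⟨n, hn⟩ := exists_nat_gt (|y - f 0| / (2 * π))
    rw [div_lt_iff₀ (by positivity)] at hn
    have h1 := abs_lt.1 hn
    have e1 := hint 0 n
    have e2 := hint 0 (-n)
    push_cast at e1 e2
    rw [zero_add] at e1 e2
    obtain ⟨x, -, hx⟩ := intermediate_value_Icc
      (by nlinarith [(Nat.cast_nonneg n : (0 : ℝ) ≤ n)] :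
        -(n : ℝ) * (2 * π) ≤ n * (2 * π)) hf.continuous.continuousOn
      (show y ∈ Icc (f (-(n : ℝ) * (2 * π))) (f (n * (2 * π))) by
        rw [e1, e2]; constructor <;> linarith)
    exact ⟨x, hx⟩
  let Φ : Real.Angle → Real.Angle := hP.lift
  have hΦ (x : ℝ) : Φ x = (f x : ℝ) := hP.lift_coe x
  have hinj : Function.Injective Φ := by
    intro a b h
    induction a using Real.Angle.induction_on with
    | _ x =>
      induction b using Real.Angle.induction_on with
      | _ y =>
        rw [hΦ, hΦ] at h
        obtain ⟨n, hn⟩ := Real.Angle.angle_eq_iff_two_pi_dvd_sub.1 h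
        have hxy : x = y + n * (2 * π) := hmono.injective (by rw [hint]; linarith)
        exact Real.Angle.angle_eq_iff_two_pi_dvd_sub.2 ⟨n, by linarith⟩
  have hsur : Function.Surjective Φ := by
    intro b
    induction b using Real.Angle.induction_on with
    | _ y =>
      obtain ⟨x, hx⟩ := hsurj y
      exact ⟨x, by rw [hΦ, hx]⟩
  have hl : IsLift f (Equiv.ofBijective Φ ⟨hinj, hsur⟩ : Equiv.Perm Real.Angle) := ⟨hf, hd, hΦ⟩
  exact ⟨⟨Equiv.ofBijective Φ ⟨hinj, hsur⟩, f, hl⟩, hl⟩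

end DiffPlus

theorem bott_eq_of_isLift {φ ψ : DiffPlus} {g : ℝ → ℝ} (hg : IsLift g ψ.1) :
    bott φ ψ = ∫ x in (0 : ℝ)..(2 * π), φ.logJac (g x) * deriv ψ.logJac x := by
  unfold bott
  refine intervalIntegral.integral_congr fun x _ => ?_
  rw [IsLift.periodic_apply_eq φ.logJac_periodic
    ((ψ.isLift.apply_coe x).symm.trans (hg.apply_coe x))]

/-- The cocycle on `(φ, ψ⁻¹)`, without the inverse: the substitution `x = ψ y` is the cocycle
identity. -/
theorem bott_inv_right (φ ψ : DiffPlus) :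
    bott φ ψ⁻¹ = -∫ x in (0 : ℝ)..(2 * π), φ.logJac x * deriv ψ.logJac x := by
  have h := bott_cocycle φ ψ⁻¹ ψ
  rw [inv_mul_cancel, bott_one_right, bott_inv_left] at h
  have e : ∀ x, (φ * ψ⁻¹).logJac (ψ.lift x) = φ.logJac x - ψ.logJac x := fun x => by
    have := DiffPlus.logJac_mul (φ * ψ⁻¹) ψ x
    rw [inv_mul_cancel_right] at this
    linarith
  have hi (χ : DiffPlus) :
      IntervalIntegrable (fun x => χ.logJac x * deriv ψ.logJac x) volume 0 (2 * π) :=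
    (χ.logJac_contDiff.continuous.mul
      (contDiff_deriv ψ.logJac_contDiff).continuous).intervalIntegrable _ _
  have : bott (φ * ψ⁻¹) ψ = ∫ x in (0 : ℝ)..(2 * π), φ.logJac x * deriv ψ.logJac x := by
    unfold bott
    simp only [e, sub_mul]
    rw [intervalIntegral.integral_sub (hi φ) (hi ψ),
      integral_periodic_deriv_self ψ.logJac_contDiff ψ.logJac_periodic, sub_zero]
  linarith

/-! ### Smooth families in the Virasoro–Bott group -/

/-- `F` and `θ` are smooth lifts over the open set `W` of the two components of the family `Γ`. -/
structure IsSmoothLift {P : Type} [NormedAddCommGroup P] [NormedSpace ℝ P] (Γ : P → VBGroup)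
    (W : Set P) (F : P × ℝ → ℝ) (θ : P → ℝ) : Prop where
  isOpen : IsOpen W
  contDiffOn : ContDiffOn ℝ ∞ F (W ×ˢ univ)
  contDiffOn_circ : ContDiffOn ℝ ∞ θ W
  apply_coe : ∀ p ∈ W, ∀ x : ℝ, (Γ p).diff (x : Real.Angle) = (F (p, x) : Real.Angle)
  circ_eq : ∀ p ∈ W, (Γ p).circ = Circle.exp (θ p)

section

variable {P : Type} [NormedAddCommGroup P] [NormedSpace ℝ P]

theorem IsSmoothOn.exists_isSmoothLift {Γ : P → VBGroup} {W : Set P} (h : IsSmoothOn Γ W)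
    (hW : IsOpen W) : ∃ F θ, IsSmoothLift Γ W F θ := by
  obtain ⟨F, θ, hF, hθ, h⟩ := h
  exact ⟨F, θ, hW, hF, hθ, fun p hp => (h p hp).1, fun p hp => (h p hp).2⟩

/-- `log ∂_y F`. -/
noncomputable def logSlope (F : P × ℝ → ℝ) (q : P × ℝ) : ℝ := Real.log (dirDeriv (0, 1) F q)

/-- The central component of the right logarithmic derivative in the direction `v` of the family
with lifts `F` and `θ`: `∂_v θ / 4π - ½ ∫ ∂_v L ∂_y L dy` with `L = log ∂_y F`. -/
noncomputable def circVelocity (F : P × ℝ → ℝ) (θ : P → ℝ) (v : P) (p : P) : ℝ :=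
  dirDeriv v θ p / (4 * π) - 1 / 2 * ∫ y in (0 : ℝ)..(2 * π),
    dirDeriv (v, 0) (logSlope F) (p, y) * dirDeriv (0, 1) (logSlope F) (p, y)

namespace IsSmoothLift

variable {Γ : P → VBGroup} {W : Set P} {F : P × ℝ → ℝ} {θ : P → ℝ} {p : P}

theorem isOpen_prod (h : IsSmoothLift Γ W F θ) : IsOpen (W ×ˢ (univ : Set ℝ)) :=
  h.isOpen.prod isOpen_univ

theorem hasDerivAt (h : IsSmoothLift Γ W F θ) (hp : p ∈ W) (y : ℝ) :
    HasDerivAt (fun y => F (p, y)) (dirDeriv (0, 1) F (p, y)) y :=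
  hasDerivAt_comp_curve (hasDerivAt_mk_right p y)
    (differentiableAt_of_contDiffOn h.contDiffOn h.isOpen_prod ⟨hp, mem_univ _⟩)

theorem contDiff_slice {G : P × ℝ → ℝ} (hG : ContDiffOn ℝ ∞ G (W ×ˢ univ)) (hp : p ∈ W) :
    ContDiff ℝ ∞ fun y => G (p, y) :=
  contDiffOn_univ.1 (hG.comp (contDiff_const.prodMk contDiff_id).contDiffOn fun _ hy => ⟨hp, hy⟩)

theorem isLift (h : IsSmoothLift Γ W F θ) (hp : p ∈ W) :
    IsLift (fun y => F (p, y)) (Γ p).diff.1 := by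
  have hc := contDiff_slice h.contDiffOn hp
  have hl := (Γ p).diff.isLift
  refine ⟨hc, fun x => ?_, h.apply_coe p hp⟩
  have e := sub_eq_of_coe_eq hc.continuous hl.contDiff.continuous
    (fun x => (h.apply_coe p hp x).symm.trans (hl.apply_coe x))
  have e' : (fun y => F (p, y)) = fun y => (Γ p).diff.lift y + (F (p, 0) - (Γ p).diff.lift 0) :=
    funext fun y => by linarith [e y]
  rw [e', deriv_add_const]
  exact hl.deriv_pos x

theorem dirDeriv_pos (h : IsSmoothLift Γ W F θ) (hp : p ∈ W) (y : ℝ) :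
    0 < dirDeriv (0, 1) F (p, y) := by
  rw [← (h.hasDerivAt hp y).deriv]
  exact (h.isLift hp).deriv_pos y

theorem add_two_pi (h : IsSmoothLift Γ W F θ) (hp : p ∈ W) (y : ℝ) :
    F (p, y + 2 * π) = F (p, y) + 2 * π := (h.isLift hp).add_two_pi y

theorem contDiffOn_logSlope (h : IsSmoothLift Γ W F θ) :
    ContDiffOn ℝ ∞ (logSlope F) (W ×ˢ univ) :=
  (contDiffOn_dirDeriv h.contDiffOn h.isOpen_prod _).log fun q hq => (h.dirDeriv_pos hq.1 q.2).ne'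

theorem logJac_eq (h : IsSmoothLift Γ W F θ) (hp : p ∈ W) :
    (Γ p).diff.logJac = fun y => logSlope F (p, y) := by
  funext y
  unfold DiffPlus.logJac logSlope
  rw [DiffPlus.jac_eq (h.isLift hp), (h.hasDerivAt hp y).deriv]

theorem deriv_logJac_eq (h : IsSmoothLift Γ W F θ) (hp : p ∈ W) (y : ℝ) :
    deriv (Γ p).diff.logJac y = dirDeriv (0, 1) (logSlope F) (p, y) := by
  rw [h.logJac_eq hp]
  exact (hasDerivAt_comp_curve (hasDerivAt_mk_right p y)
    (differentiableAt_of_contDiffOn h.contDiffOn_logSlope h.isOpen_prod ⟨hp, mem_univ _⟩)).deriv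

/-- The fibrewise inverse of the lifts. -/
theorem exists_inverse [CompleteSpace P] (h : IsSmoothLift Γ W F θ) :
    ∃ Ψ : P × ℝ → ℝ, ContDiffOn ℝ ∞ Ψ (W ×ˢ univ) ∧ (∀ p ∈ W, ∀ y, Ψ (p, F (p, y)) = y) ∧
      ∀ p ∈ W, ∀ x, F (p, Ψ (p, x)) = x := by
  refine ⟨fun q => Function.invFun (fun y => F (q.1, y)) q.2, ?_, ?_, ?_⟩
  · refine contDiffOn_fiberwise_inverse h.isOpen h.contDiffOn
      (fun p hp y => (h.dirDeriv_pos hp y).ne') ?_ ?_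
    · exact fun p hp y => Function.leftInverse_invFun (h.isLift hp).strictMono.injective y
    · exact fun p hp x => Function.rightInverse_invFun (h.isLift hp).surjective x
  · exact fun p hp y => Function.leftInverse_invFun (h.isLift hp).strictMono.injective y
  · exact fun p hp x => Function.rightInverse_invFun (h.isLift hp).surjective x

end IsSmoothLift

/-- The partial derivatives of a family of functions with `G (p, y + T) = G (p, y) + c` are
periodic. -/
theorem dirDeriv_add_period {W : Set P} {G : P × ℝ → ℝ} {T c : ℝ} (hW : IsOpen W)
    (h : ∀ p ∈ W, ∀ y, G (p, y + T) = G (p, y) + c)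
    (v : P × ℝ) {p : P} (hp : p ∈ W) (y : ℝ) :
    dirDeriv v G (p, y + T) = dirDeriv v G (p, y) := by
  have hO : IsOpen (W ×ˢ (univ : Set ℝ)) := hW.prod isOpen_univ
  have e : (p, y + T) = ((p, y) : P × ℝ) + (0, T) := by simp
  have h1 : dirDeriv v (fun q => G (q + (0, T))) (p, y) = dirDeriv v (fun q => G q + c) (p, y) :=
    dirDeriv_congr hO (fun q hq => by
      obtain ⟨r, z⟩ := q
      have : ((r, z) : P × ℝ) + (0, T) = (r, z + T) := by simp
      simp only [this]
      exact h r hq.1 z) ⟨hp, mem_univ _⟩ v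
  unfold dirDeriv at h1 ⊢
  rw [e, ← fderiv_comp_add_right, h1, fderiv_add_const]

theorem HasRightLogDeriv.unique {γ : ℝ → VBGroup} {t : ℝ} {X Y : VirAlg}
    (hX : HasRightLogDeriv γ t X) (hY : HasRightLogDeriv γ t Y) : X = Y := by
  refine VirAlg.ext (fun x => (hX.1 x).unique (hY.1 x)) ?_
  have := hX.2.unique hY.2
  have hpi := Real.pi_pos
  exact mul_left_cancel₀ (by positivity) this

theorem HasRightLogDeriv.rightLogDeriv_eq {γ : ℝ → VBGroup} {t : ℝ} {X : VirAlg}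
    (hX : HasRightLogDeriv γ t X) : rightLogDeriv γ t = X := by
  have h : ∃ X, HasRightLogDeriv γ t X := ⟨X, hX⟩
  unfold rightLogDeriv
  rw [dif_pos h]
  exact h.choose_spec.unique hX

namespace IsSmoothLift

variable {Γ : P → VBGroup} {W : Set P} {F : P × ℝ → ℝ} {θ : P → ℝ}

theorem contDiffOn_circVelocity (h : IsSmoothLift Γ W F θ) (v : P) :
    ContDiffOn ℝ ∞ (circVelocity F θ v) W := by
  have hL := h.contDiffOn_logSlope
  have h1 := contDiffOn_parametric_integral (a := 0) (b := 2 * π) h.isOpen isOpen_univ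
    ((contDiffOn_dirDeriv hL h.isOpen_prod (v, 0)).mul
      (contDiffOn_dirDeriv hL h.isOpen_prod (0, 1))) (subset_univ _)
  exact ((contDiffOn_dirDeriv h.contDiffOn_circ h.isOpen v).div_const _).sub
    (contDiffOn_const.mul h1)

/-- The right logarithmic derivative in Lagrangian coordinates: its first component `u` satisfies
`u ∘ F = ∂_v F`, and its second component is `circVelocity`. -/
theorem hasRightLogDeriv [CompleteSpace P] (h : IsSmoothLift Γ W F θ) {c : ℝ → P} {v : P} {t : ℝ}
    (hc : HasDerivAt c v t) (hp : c t ∈ W) {γ : ℝ → VBGroup}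
    (hγ : ∀ᶠ τ in 𝓝 t, γ τ = Γ (c τ)) {X : VirAlg}
    (h1 : ∀ y, X.1 (F (c t, y)) = dirDeriv (v, 0) F (c t, y))
    (h2 : X.2 = circVelocity F θ v (c t)) : HasRightLogDeriv γ t X := by
  obtain ⟨Ψ, -, -, hr⟩ := h.exists_inverse
  have hW : ∀ᶠ τ in 𝓝 t, c τ ∈ W := hc.continuousAt (h.isOpen.mem_nhds hp)
  have hγt : γ t = Γ (c t) := hγ.self_of_nhds
  have hinv (x : ℝ) : (γ t).diff⁻¹ (x : Real.Angle) = (Ψ (c t, x) : ℝ) := by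
    apply DiffPlus.inv_apply_eq
    rw [hγt, h.apply_coe _ hp, hr _ hp]
  constructor
  · intro x
    have hd : HasDerivAt (fun τ => F (c τ, Ψ (c t, x)) - x) (X.1 x) t := by
      have e := h1 (Ψ (c t, x))
      rw [hr _ hp] at e
      rw [e]
      exact (hasDerivAt_comp_curve (hasDerivAt_mk_left hc _)
        (differentiableAt_of_contDiffOn h.contDiffOn h.isOpen_prod ⟨hp, mem_univ _⟩)).sub_const x
    refine (hasDerivAt_toReal_coe hd (by simp [hr _ hp])).congr_of_eventuallyEq ?_
    filter_upwards [hW, hγ] with τ hτ hγτ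
    simp only [VBGroup.mul_diff, VBGroup.inv_diff]
    rw [DiffPlus.coe_mul_apply, hinv, hγτ, h.apply_coe _ hτ, Real.Angle.coe_sub]
  · have hL := h.contDiffOn_logSlope
    set G : P × ℝ → ℝ := fun q => logSlope F q * dirDeriv (0, 1) (logSlope F) (c t, q.2) with hG
    have hGs : ContDiffOn ℝ ∞ G (W ×ˢ univ) := hL.mul
      ((contDiffOn_dirDeriv hL h.isOpen_prod (0, 1)).comp
        (contDiff_const.prodMk contDiff_snd).contDiffOn fun q _ => ⟨hp, mem_univ _⟩)
    have hGi := contDiffOn_parametric_integral (a := 0) (b := 2 * π) h.isOpen isOpen_univ hGs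
      (subset_univ _)
    have hGd : dirDeriv v (fun q => ∫ y in (0 : ℝ)..(2 * π), G (q, y)) (c t)
        = ∫ y in (0 : ℝ)..(2 * π),
          dirDeriv (v, 0) (logSlope F) (c t, y) * dirDeriv (0, 1) (logSlope F) (c t, y) := by
      rw [dirDeriv_parametric_integral h.isOpen isOpen_univ hGs (subset_univ _) hp]
      refine intervalIntegral.integral_congr fun y _ => ?_
      have d1 : HasDerivAt (fun τ => G (c τ, y)) (dirDeriv (v, 0) G (c t, y)) t :=
        hasDerivAt_comp_curve (hasDerivAt_mk_left hc y)
          (differentiableAt_of_contDiffOn hGs h.isOpen_prod ⟨hp, mem_univ _⟩)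
      have d2 := (hasDerivAt_comp_curve (hasDerivAt_mk_left hc y)
          (differentiableAt_of_contDiffOn hL h.isOpen_prod ⟨hp, mem_univ _⟩)).mul_const
          (dirDeriv (0, 1) (logSlope F) (c t, y))
      exact d1.unique d2
    have hd : HasDerivAt (fun τ => θ (c τ) - θ (c t)
        + 2 * π * -∫ y in (0 : ℝ)..(2 * π), G (c τ, y)) (4 * π * X.2) t := by
      have d1 := hasDerivAt_comp_curve hc
        (differentiableAt_of_contDiffOn h.contDiffOn_circ h.isOpen hp)
      have d2 := hasDerivAt_comp_curve hc (differentiableAt_of_contDiffOn hGi h.isOpen hp)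
      refine ((d1.sub_const (θ (c t))).add (d2.neg.const_mul (2 * π))).congr_deriv ?_
      rw [hGd, h2]
      unfold circVelocity
      have hpi := Real.pi_pos
      field_simp
      ring
    have hcirc : ∀ τ, c τ ∈ W → γ τ = Γ (c τ) → (γ τ * (γ t)⁻¹).circ
        = Circle.exp (θ (c τ) - θ (c t) + 2 * π * -∫ y in (0 : ℝ)..(2 * π), G (c τ, y)) := by
      intro τ hτ hγτ
      rw [VBGroup.mul_circ, VBGroup.inv_circ, VBGroup.inv_diff, bott_inv_right, Circle.exp_add,
        Circle.exp_sub, hγτ, hγt, h.circ_eq _ hτ, h.circ_eq _ hp, div_eq_mul_inv]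
      simp only [h.deriv_logJac_eq hp, h.logJac_eq hτ, hG]
    refine (hasDerivAt_arg_exp hd ?_).congr_of_eventuallyEq ?_
    · rw [← hcirc t hp hγt, mul_inv_cancel]
      rfl
    · filter_upwards [hW, hγ] with τ hτ hγτ
      rw [hcirc τ hτ hγτ]

/-- The Lagrangian description of the right logarithmic derivative defines an element of the Lie
algebra. -/
theorem exists_virAlg [CompleteSpace P] (h : IsSmoothLift Γ W F θ) {p : P} (hp : p ∈ W) (v : P) :
    ∃ X : VirAlg, (∀ y, X.1 (F (p, y)) = dirDeriv (v, 0) F (p, y)) ∧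
      X.2 = circVelocity F θ v p := by
  obtain ⟨Ψ, hΨ, hl, hr⟩ := h.exists_inverse
  have hper (x : ℝ) : Ψ (p, x + 2 * π) = Ψ (p, x) + 2 * π := by
    rw [← hl p hp (Ψ (p, x) + 2 * π), h.add_two_pi hp, hr p hp]
  refine ⟨(⟨fun x => dirDeriv (v, 0) F (p, Ψ (p, x)), ?_, fun x => ?_⟩, _), fun y => ?_, rfl⟩
  · exact (contDiff_slice (contDiffOn_dirDeriv h.contDiffOn h.isOpen_prod _) hp).comp
      (contDiff_slice hΨ hp)
  · simp only [hper]
    exact dirDeriv_add_period h.isOpen (fun p hp y => h.add_two_pi hp y) _ hp _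
  · change dirDeriv (v, 0) F (p, Ψ (p, F (p, y))) = _
    rw [hl p hp]

theorem rightLogDeriv_spec [CompleteSpace P] (h : IsSmoothLift Γ W F θ) {c : ℝ → P} {v : P}
    {t : ℝ} (hc : HasDerivAt c v t) (hp : c t ∈ W) {γ : ℝ → VBGroup}
    (hγ : ∀ᶠ τ in 𝓝 t, γ τ = Γ (c τ)) :
    HasRightLogDeriv γ t (rightLogDeriv γ t) ∧
      (∀ y, (rightLogDeriv γ t).1 (F (c t, y)) = dirDeriv (v, 0) F (c t, y)) ∧
      (rightLogDeriv γ t).2 = circVelocity F θ v (c t) := by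
  obtain ⟨X, h1, h2⟩ := h.exists_virAlg hp v
  have hX := h.hasRightLogDeriv hc hp hγ h1 h2
  rw [hX.rightLogDeriv_eq]
  exact ⟨hX, h1, h2⟩

end IsSmoothLift

end

/-! ### The adjoint of `ad` -/

/-- The vector field `2 h' ℓ + h ℓ' + c h'''`. -/
noncomputable def coadjointField (h l : VectS1) (c : ℝ) : VectS1 :=
  ⟨fun x => 2 * h.D x * l x + h x * l.D x + c * h.D.D.D x,
    (((contDiff_const.mul h.D.contDiff).mul l.contDiff).add
      (h.contDiff.mul l.D.contDiff)).add (contDiff_const.mul h.D.D.D.contDiff), fun x => by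
      simp only [h.periodic x, h.D.periodic x, h.D.D.D.periodic x, l.periodic x, l.D.periodic x]⟩

theorem coadjointField_apply (h l : VectS1) (c x : ℝ) :
    coadjointField h l c x = 2 * h.D x * l x + h x * l.D x + c * h.D.D.D x := rfl

theorem iteratedDeriv_three (h : VectS1) (x : ℝ) : iteratedDeriv 3 h x = h.D.D.D x := by
  rw [iteratedDeriv_succ, iteratedDeriv_succ, iteratedDeriv_one]
  rfl

theorem VectS1.apply_two_pi (f : VectS1) : f (2 * π) = f 0 := by simpa using f.periodic 0

theorem VectS1.continuous (f : VectS1) : Continuous (f : ℝ → ℝ) := f.contDiff.continuous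

theorem isAdTranspose_coadjointField (h l : VectS1) (a c : ℝ) :
    IsAdTranspose (h, a) (l, c) (coadjointField h l c, 0) := by
  intro V
  obtain ⟨k, b⟩ := V
  -- the difference of the integrands is the derivative of a periodic function
  let B : ℝ → ℝ := fun x => c * (h.D x * k.D x - h.D.D x * k x) - h x * l x * k x
  have hB : ∀ x ∈ uIcc (0 : ℝ) (2 * π), HasDerivAt B ((h.D x * k x - h x * k.D x) * l x
      + c * (h.D x * k.D.D x) - k x * coadjointField h l c x) x := fun x _ => by
    have := ((((h.D.hasDerivAt x).mul (k.D.hasDerivAt x)).sub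
      ((h.D.D.hasDerivAt x).mul (k.hasDerivAt x))).const_mul c).sub
      (((h.hasDerivAt x).mul (l.hasDerivAt x)).mul (k.hasDerivAt x))
    refine this.congr_deriv ?_
    simp only [coadjointField_apply, Pi.mul_apply]
    ring
  have i1 : IntervalIntegrable (fun x => (h.D x * k x - h x * k.D x) * l x) volume 0 (2 * π) :=
    (((h.D.continuous.mul k.continuous).sub (h.continuous.mul k.D.continuous)).mul
      l.continuous).intervalIntegrable _ _
  have i2 : IntervalIntegrable (fun x => c * (h.D x * k.D.D x)) volume 0 (2 * π) :=
    (VectS1.intervalIntegrable_mul _ _ _ _).const_mul c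
  have i3 := VectS1.intervalIntegrable_mul k (coadjointField h l c) 0 (2 * π)
  have key := intervalIntegral.integral_eq_sub_of_hasDerivAt hB ((i1.add i2).sub i3)
  have p0 : B (2 * π) = B 0 := by simp only [B, VectS1.apply_two_pi]
  rw [p0, sub_self, intervalIntegral.integral_sub (i1.add i2) i3,
    intervalIntegral.integral_add i1 i2, intervalIntegral.integral_const_mul] at key
  change (∫ x in (0 : ℝ)..(2 * π), (h.D x * k x - h x * k.D x) * l x) + omega h k * c
    = (∫ x in (0 : ℝ)..(2 * π), k x * coadjointField h l c x) + b * 0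
  unfold omega
  linarith

/-- A continuous function on an interval whose square has integral `0` vanishes. -/
theorem eq_zero_of_integral_sq_eq_zero {f : ℝ → ℝ} {a b : ℝ} (hab : a < b)
    (hf : ContinuousOn f (Icc a b)) (h : ∫ x in a..b, f x ^ 2 = 0) :
    ∀ x ∈ Icc a b, f x = 0 := by
  by_contra! hcon
  obtain ⟨x, hx, hfx⟩ := hcon
  have := intervalIntegral.integral_pos (f := fun x => f x ^ 2) hab (hf.pow 2)
    (fun x _ => sq_nonneg _) ⟨x, hx, sq_pos_of_ne_zero hfx⟩
  linarith

theorem VectS1.eq_zero_of_integral_sq (f : VectS1)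
    (h : ∫ x in (0 : ℝ)..(2 * π), f x ^ 2 = 0) (x : ℝ) : f x = 0 := by
  obtain ⟨y, hy, e⟩ := f.periodic.exists_mem_Ico₀ Real.two_pi_pos x
  rw [e]
  exact eq_zero_of_integral_sq_eq_zero Real.two_pi_pos f.continuous.continuousOn h y
    ⟨hy.1, hy.2.le⟩

theorem IsAdTranspose.unique {X Y V W : VirAlg} (hV : IsAdTranspose X Y V)
    (hW : IsAdTranspose X Y W) : V = W := by
  have h := (hV (V - W)).symm.trans (hW (V - W))
  have e : l2Inner (V - W) V - l2Inner (V - W) W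
      = (∫ x in (0 : ℝ)..(2 * π), (V - W).1 x ^ 2) + (V - W).2 ^ 2 := by
    have hs (x : ℝ) : (V - W).1 x ^ 2 = (V - W).1 x * V.1 x - (V - W).1 x * W.1 x := by
      have : (V - W).1 x = V.1 x - W.1 x := rfl
      rw [this]; ring
    have hs2 : (V - W).2 = V.2 - W.2 := rfl
    simp only [hs]
    rw [intervalIntegral.integral_sub (VectS1.intervalIntegrable_mul _ _ _ _)
      (VectS1.intervalIntegrable_mul _ _ _ _)]
    unfold l2Inner
    rw [hs2]
    ring
  rw [h, sub_self] at e
  have h1 : 0 ≤ ∫ x in (0 : ℝ)..(2 * π), (V - W).1 x ^ 2 :=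
    intervalIntegral.integral_nonneg Real.two_pi_pos.le fun x _ => sq_nonneg _
  have h2 : (V - W).2 ^ 2 = 0 := le_antisymm (by linarith) (sq_nonneg _)
  refine VirAlg.ext (fun x => sub_eq_zero.1 ?_) (sub_eq_zero.1 (pow_eq_zero_iff two_ne_zero |>.1 h2))
  exact (V - W).1.eq_zero_of_integral_sq (by linarith) x

theorem isAdTranspose_iff (h l : VectS1) (a c : ℝ) (W : VirAlg) :
    IsAdTranspose (h, a) (l, c) W ↔
      (∀ x : ℝ, W.1 x = 2 * deriv h x * l x + h x * deriv l x + c * iteratedDeriv 3 h x) ∧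
      W.2 = 0 := by
  simp only [iteratedDeriv_three]
  constructor
  · intro hW
    rw [hW.unique (isAdTranspose_coadjointField h l a c)]
    exact ⟨fun x => rfl, rfl⟩
  · rintro ⟨h1, h2⟩
    have : W = (coadjointField h l c, 0) := VirAlg.ext h1 h2
    rw [this]
    exact isAdTranspose_coadjointField h l a c

/-! ### Construction of smooth families -/

section

variable {P : Type} [NormedAddCommGroup P] [NormedSpace ℝ P] {W : Set P} {F : P × ℝ → ℝ}
  {θ : P → ℝ}

theorem exists_family_isSmoothLift (hW : IsOpen W) (hF : ContDiffOn ℝ ∞ F (W ×ˢ univ))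
    (hθ : ContDiffOn ℝ ∞ θ W) (hd : ∀ p ∈ W, ∀ y, 0 < dirDeriv (0, 1) F (p, y))
    (hp : ∀ p ∈ W, ∀ y, F (p, y + 2 * π) = F (p, y) + 2 * π) :
    ∃ Γ : P → VBGroup, IsSmoothLift Γ W F θ := by
  have hex : ∀ p, ∃ g : VBGroup, p ∈ W → (∀ x : ℝ, g.diff (x : Real.Angle) = (F (p, x) : ℝ)) ∧
      g.circ = Circle.exp (θ p) := by
    intro p
    by_cases hpW : p ∈ W
    · have hs : ContDiff ℝ ∞ fun y => F (p, y) := IsSmoothLift.contDiff_slice hF hpW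
      have hy (y : ℝ) : HasDerivAt (fun y => F (p, y)) (dirDeriv (0, 1) F (p, y)) y :=
        hasDerivAt_comp_curve (hasDerivAt_mk_right p y)
          (differentiableAt_of_contDiffOn hF (hW.prod isOpen_univ) ⟨hpW, mem_univ _⟩)
      obtain ⟨φ, hφ⟩ := DiffPlus.exists_isLift hs
        (fun x => by rw [(hy x).deriv]; exact hd p hpW x) (hp p hpW)
      exact ⟨⟨φ, Circle.exp (θ p)⟩, fun _ => ⟨hφ.apply_coe, rfl⟩⟩
    · exact ⟨1, fun h => absurd h hpW⟩
  choose Γ hΓ using hex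
  exact ⟨Γ, hW, hF, hθ, fun p hp => (hΓ p hp).1, fun p hp => (hΓ p hp).2⟩

theorem IsSmoothLift.isSmoothOn {Γ : P → VBGroup} (h : IsSmoothLift Γ W F θ) : IsSmoothOn Γ W :=
  ⟨F, θ, h.contDiffOn, h.contDiffOn_circ, fun p hp => ⟨h.apply_coe p hp, h.circ_eq p hp⟩⟩

theorem IsSmoothLift.eq_of_lift {Γ : P → VBGroup} (h : IsSmoothLift Γ W F θ) {p : P} (hp : p ∈ W)
    {g : VBGroup} (h1 : ∀ x : ℝ, g.diff (x : Real.Angle) = (F (p, x) : ℝ))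
    (h2 : g.circ = Circle.exp (θ p)) : Γ p = g :=
  VBGroup.ext (DiffPlus.ext_of_coe fun x => by rw [h.apply_coe p hp, h1])
    (by rw [h.circ_eq p hp, h2])

theorem dirDeriv_left_eq {G : P × ℝ → ℝ} {c : ℝ → P} {v : P} {t y d : ℝ} (hW : IsOpen W)
    (hG : ContDiffOn ℝ ∞ G (W ×ˢ univ)) (hc : HasDerivAt c v t) (ht : c t ∈ W)
    (hd : HasDerivAt (fun τ => G (c τ, y)) d t) : dirDeriv (v, 0) G (c t, y) = d :=
  (hasDerivAt_comp_curve (hasDerivAt_mk_left hc y)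
    (differentiableAt_of_contDiffOn hG (hW.prod isOpen_univ) ⟨ht, mem_univ _⟩)).unique hd

theorem dirDeriv_right_eq {G : P × ℝ → ℝ} {g : ℝ → ℝ} {p : P} {y d : ℝ} (hW : IsOpen W)
    (hG : ContDiffOn ℝ ∞ G (W ×ˢ univ)) (hp : p ∈ W) (hg : ∀ y, G (p, y) = g y)
    (hd : HasDerivAt g d y) : dirDeriv (0, 1) G (p, y) = d :=
  (hasDerivAt_comp_curve (hasDerivAt_mk_right p y)
    (differentiableAt_of_contDiffOn hG (hW.prod isOpen_univ) ⟨hp, mem_univ _⟩)).unique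
    (by rw [funext hg]; exact hd)

/-- A positive function stays positive under small perturbations, uniformly over a compact set of
parameters and over the circle. -/
theorem exists_perturbation_pos {G H : ℝ × ℝ → ℝ} {J C : Set ℝ} (hJ : IsOpen J)
    (hG : ContinuousOn G (J ×ˢ univ)) (hH : ContinuousOn H (J ×ˢ univ)) (hC : IsCompact C)
    (hCJ : C ⊆ J) (hpos : ∀ t ∈ C, ∀ y, 0 < G (t, y))
    (hGp : ∀ t ∈ C, ∀ y, G (t, y + 2 * π) = G (t, y))
    (hHp : ∀ t ∈ C, ∀ y, H (t, y + 2 * π) = H (t, y)) :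
    ∃ K : Set ℝ, IsOpen K ∧ (0 : ℝ) ∈ K ∧ ∀ t ∈ C, ∀ s ∈ K, ∀ y, 0 < G (t, y) + s * H (t, y) := by
  have hO : IsOpen ((univ : Set ℝ) ×ˢ (J ×ˢ (univ : Set ℝ))) :=
    isOpen_univ.prod (hJ.prod isOpen_univ)
  have hcont : ContinuousOn (fun q : ℝ × (ℝ × ℝ) => G q.2 + q.1 * H q.2)
      ((univ : Set ℝ) ×ˢ (J ×ˢ (univ : Set ℝ))) :=
    (hG.comp continuousOn_snd fun q hq => hq.2).add
      (continuousOn_fst.mul (hH.comp continuousOn_snd fun q hq => hq.2))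
  obtain ⟨u, v, hu, -, h0u, hv, huv⟩ := generalized_tube_lemma
    (isCompact_singleton (x := (0 : ℝ))) (hC.prod (isCompact_Icc (a := (0 : ℝ)) (b := 2 * π)))
    (hcont.isOpen_inter_preimage hO isOpen_Ioi) (by
      rintro ⟨s, q⟩ ⟨rfl, hq⟩
      refine ⟨⟨mem_univ _, hCJ hq.1, mem_univ _⟩, ?_⟩
      simpa using hpos q.1 hq.1 q.2)
  refine ⟨u, hu, h0u rfl, fun t ht s hs y => ?_⟩
  have hper : Function.Periodic (fun y => G (t, y) + s * H (t, y)) (2 * π) := fun y => by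
    simp only [hGp t ht, hHp t ht]
  obtain ⟨z, hz, e⟩ := hper.exists_mem_Ico₀ Real.two_pi_pos y
  rw [show G (t, y) + s * H (t, y) = G (t, z) + s * H (t, z) from e]
  exact (huv (Set.mk_mem_prod hs (hv (Set.mk_mem_prod ht ⟨hz.1, hz.2.le⟩)))).2

end

/-- Every element of the Lie algebra is the velocity at the unit of the curve with lifts
`y + t h(y)` and `4π a t`. -/
theorem exists_curve_hasRightLogDeriv (X : VirAlg) :
    ∃ (J : Set ℝ) (γ : ℝ → VBGroup), IsOpen J ∧ (0 : ℝ) ∈ J ∧ IsSmoothOn γ J ∧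
      γ 0 = 1 ∧ HasRightLogDeriv γ 0 X := by
  obtain ⟨J, hJ, h0, hpos⟩ := exists_perturbation_pos (G := fun _ => 1) (H := fun q => X.1.D q.2)
    isOpen_univ continuousOn_const (X.1.D.continuous.comp continuous_snd).continuousOn
    (isCompact_singleton (x := (0 : ℝ))) (subset_univ _) (fun _ _ _ => one_pos)
    (fun _ _ _ => rfl) (fun _ _ y => X.1.D.periodic y)
  set F : ℝ × ℝ → ℝ := fun q => q.2 + q.1 * X.1 q.2 with hF
  set θ : ℝ → ℝ := fun t => 4 * π * X.2 * t
  have hFs : ContDiffOn ℝ ∞ F (J ×ˢ univ) :=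
    (contDiff_snd.add (contDiff_fst.mul (X.1.contDiff.comp contDiff_snd))).contDiffOn
  have hθs : ContDiffOn ℝ ∞ θ J := (contDiff_const.mul contDiff_id).contDiffOn
  have hFy : ∀ t ∈ J, ∀ y, dirDeriv (0, 1) F (t, y) = 1 + t * X.1.D y := fun t ht y =>
    dirDeriv_right_eq hJ hFs ht (fun _ => rfl)
      ((hasDerivAt_id y).add ((X.1.hasDerivAt y).const_mul t))
  obtain ⟨γ, hγ⟩ := exists_family_isSmoothLift hJ hFs hθs
    (fun t ht y => by rw [hFy t ht]; exact hpos 0 rfl t ht y)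
    (fun t ht y => by simp only [hF, X.1.periodic y]; ring)
  have hid (t : ℝ) : HasDerivAt (fun τ : ℝ => τ) 1 t := hasDerivAt_id t
  refine ⟨J, γ, hJ, h0, hγ.isSmoothOn, hγ.eq_of_lift h0 (fun x => ?_) ?_, ?_⟩
  · simp [hF]; rfl
  · simp [θ]
  · refine hγ.hasRightLogDeriv (hid 0) h0 (Filter.Eventually.of_forall fun _ => rfl) ?_ ?_
    · intro y
      rw [dirDeriv_left_eq (d := X.1 y) hJ hFs (hid 0) h0]
      · simp [hF]
      · exact (((hid 0).mul_const (X.1 y)).const_add y).congr_deriv (one_mul _)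
    · have hLy (y : ℝ) : dirDeriv (0, 1) (logSlope F) (0, y) = 0 :=
        dirDeriv_right_eq (g := fun _ => 0) hJ hγ.contDiffOn_logSlope h0
          (fun y => by simp [logSlope, hFy 0 h0]) (hasDerivAt_const y 0)
      have hθd : dirDeriv 1 θ 0 = 4 * π * X.2 := by
        have h1 := hasDerivAt_comp_curve (hid 0) (differentiableAt_of_contDiffOn hθs hJ h0)
        have h2 := (hid 0).const_mul (4 * π * X.2)
        rw [mul_one] at h2
        exact h1.unique h2
      unfold circVelocity
      simp only [hLy, hθd, mul_zero, intervalIntegral.integral_zero, sub_zero]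
      field_simp

/-! ### The Lie bracket of the group -/

/-- The partial derivatives at the unit of the lifts of a curve through the unit with velocity
`X`. -/
structure LiftAtUnit (F : ℝ × ℝ → ℝ) (X : VirAlg) : Prop where
  coe_eq : ∀ y : ℝ, ((F (0, y) : ℝ) : Real.Angle) = y
  dy : ∀ y, dirDeriv (0, 1) F (0, y) = 1
  dt : ∀ y, dirDeriv (1, 0) F (0, y) = X.1 y
  dyy : ∀ y, dirDeriv (0, 1) (dirDeriv (0, 1) F) (0, y) = 0
  dty : ∀ y, dirDeriv (1, 0) (dirDeriv (0, 1) F) (0, y) = X.1.D y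
  logSlope_eq : ∀ y, logSlope F (0, y) = 0
  logSlope_dy : ∀ y, dirDeriv (0, 1) (logSlope F) (0, y) = 0
  logSlope_dt : ∀ y, dirDeriv (1, 0) (logSlope F) (0, y) = X.1.D y
  logSlope_dty : ∀ y, dirDeriv (1, 0) (dirDeriv (0, 1) (logSlope F)) (0, y) = X.1.D.D y

theorem IsSmoothLift.liftAtUnit {γ : ℝ → VBGroup} {J : Set ℝ} {F : ℝ × ℝ → ℝ} {θ : ℝ → ℝ}
    (h : IsSmoothLift γ J F θ) (h0 : (0 : ℝ) ∈ J) (h1 : γ 0 = 1) {X : VirAlg}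
    (hX : HasRightLogDeriv γ 0 X) :
    LiftAtUnit F X ∧ X.2 = dirDeriv 1 θ 0 / (4 * π) := by
  have hO := h.isOpen_prod
  have hm (y : ℝ) : ((0, y) : ℝ × ℝ) ∈ J ×ˢ (univ : Set ℝ) := ⟨h0, mem_univ _⟩
  have hspec := h.rightLogDeriv_spec (c := fun τ => τ) (hasDerivAt_id 0) h0
    (Filter.Eventually.of_forall fun _ => rfl)
  rw [hX.rightLogDeriv_eq] at hspec
  obtain ⟨-, hX1, hX2⟩ := hspec
  have coe_eq : ∀ y : ℝ, ((F (0, y) : ℝ) : Real.Angle) = y := fun y => by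
    rw [← h.apply_coe 0 h0, h1]; rfl
  have hFy := contDiffOn_dirDeriv h.contDiffOn hO (0, 1)
  have hFt := contDiffOn_dirDeriv h.contDiffOn hO (1, 0)
  have hL := h.contDiffOn_logSlope
  have hLt := contDiffOn_dirDeriv hL hO (1, 0)
  have hFd (y : ℝ) := differentiableAt_of_contDiffOn hFy hO (hm y)
  have dy : ∀ y, dirDeriv (0, 1) F (0, y) = 1 := fun y => by
    refine dirDeriv_right_eq (g := fun y => y + F (0, 0)) h.isOpen h.contDiffOn h0 (fun y => ?_)
      ((hasDerivAt_id y).add_const _)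
    have := sub_eq_of_coe_eq (h.isLift h0).contDiff.continuous continuous_id coe_eq y
    simp only [id, sub_zero] at this
    linarith
  have dt : ∀ y, dirDeriv (1, 0) F (0, y) = X.1 y := fun y => by
    rw [← hX1]
    exact IsLift.periodic_apply_eq X.1.periodic (coe_eq y)
  have dyt : ∀ y, dirDeriv (0, 1) (dirDeriv (1, 0) F) (0, y) = X.1.D y := fun y =>
    dirDeriv_right_eq h.isOpen hFt h0 dt (X.1.hasDerivAt y)
  have dty : ∀ y, dirDeriv (1, 0) (dirDeriv (0, 1) F) (0, y) = X.1.D y := fun y => by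
    rw [dirDeriv_comm h.contDiffOn hO (hm y), dyt]
  have hL0 : ∀ y, logSlope F (0, y) = 0 := fun y => by simp [logSlope, dy]
  have hLdy : ∀ y, dirDeriv (0, 1) (logSlope F) (0, y) = 0 := fun y =>
    dirDeriv_right_eq h.isOpen hL h0 hL0 (hasDerivAt_const y 0)
  have hLdt : ∀ y, dirDeriv (1, 0) (logSlope F) (0, y) = X.1.D y := fun y => by
    change dirDeriv (1, 0) (fun q => Real.log (dirDeriv (0, 1) F q)) (0, y) = _
    rw [dirDeriv_log (hFd y) (by simp [dy]), dy, div_one, dty]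
  refine ⟨⟨coe_eq, dy, dt, fun y => dirDeriv_right_eq h.isOpen hFy h0 dy (hasDerivAt_const y 1),
    dty, hL0, hLdy, hLdt, fun y => ?_⟩, ?_⟩
  · rw [dirDeriv_comm hL hO (hm y)]
    exact dirDeriv_right_eq h.isOpen hLt h0 hLdt (X.1.D.hasDerivAt y)
  · rw [hX2]
    simp [circVelocity, hLdy]

theorem omega_swap (h k : VectS1) : omega k h = -omega h k := by
  have := omega_self (h + k)
  rw [omega_add_left, omega_add_right, omega_add_right, omega_self, omega_self] at this
  linarith

/-- The adjoint action, in Lagrangian coordinates. With `ℓ = log φ'` the derivative of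
`s ↦ φ η(s) φ⁻¹` is `(φ' k) ∘ φ⁻¹` in the first component and
`b + ½ ∫ (ℓ k'' - (ℓ' k + k') ℓ') dy` in the second. -/
theorem hasRightLogDeriv_conj {η : ℝ → VBGroup} {J : Set ℝ} {G : ℝ × ℝ → ℝ} {θ : ℝ → ℝ}
    (h : IsSmoothLift η J G θ) (h0 : (0 : ℝ) ∈ J) (h1 : η 0 = 1) {Y : VirAlg}
    (hY : HasRightLogDeriv η 0 Y) (g : VBGroup) {f : ℝ → ℝ} (hf : IsLift f g.diff.1)
    {ψ : ℝ → ℝ} (hψ : ∀ x, f (ψ x) = x) {Z : VirAlg}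
    (hZ1 : ∀ x, Z.1 x = deriv f (ψ x) * Y.1 (ψ x))
    (hZ2 : Z.2 = Y.2 + 1 / 2 * ∫ y in (0 : ℝ)..(2 * π), (g.diff.logJac y * Y.1.D.D y
      - (deriv g.diff.logJac y * Y.1 y + Y.1.D y) * deriv g.diff.logJac y)) :
    HasRightLogDeriv (fun s => g * η s * g⁻¹) 0 Z := by
  obtain ⟨hG, hY2⟩ := h.liftAtUnit h0 h1 hY
  have hO := h.isOpen_prod
  have hm (y : ℝ) : ((0, y) : ℝ × ℝ) ∈ J ×ˢ (univ : Set ℝ) := ⟨h0, mem_univ _⟩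
  have hid : HasDerivAt (fun s : ℝ => s) 1 0 := hasDerivAt_id 0
  have hJ : ∀ᶠ s in 𝓝 (0 : ℝ), s ∈ J := h.isOpen.mem_nhds h0
  have hGd (y : ℝ) : HasDerivAt (fun s => G (s, y)) (Y.1 y) 0 := by
    rw [← hG.dt]
    exact hasDerivAt_comp_curve (hasDerivAt_mk_left hid y)
      (differentiableAt_of_contDiffOn h.contDiffOn hO (hm y))
  have hinv (x : ℝ) : g.diff⁻¹ (x : Real.Angle) = (ψ x : ℝ) := by
    apply DiffPlus.inv_apply_eq
    rw [hf.apply_coe, hψ]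
  have hσ0 : g * η 0 * g⁻¹ = 1 := by rw [h1, mul_one, mul_inv_cancel]
  unfold HasRightLogDeriv
  simp only [hσ0, inv_one, mul_one]
  constructor
  · intro x
    have hd : HasDerivAt (fun s => f (G (s, ψ x)) - x) (Z.1 x) 0 := by
      have e : deriv f (G (0, ψ x)) = deriv f (ψ x) :=
        IsLift.periodic_apply_eq hf.deriv_periodic (hG.coe_eq _)
      rw [hZ1, ← e]
      exact ((hf.hasDerivAt _).comp (0 : ℝ) (hGd (ψ x))).sub_const x
    refine (hasDerivAt_toReal_coe hd ?_).congr_of_eventuallyEq ?_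
    · rw [Real.Angle.coe_sub, ← hf.apply_coe, hG.coe_eq, hf.apply_coe, hψ, sub_self]
    · filter_upwards [hJ] with s hs
      simp only [VBGroup.mul_diff, VBGroup.inv_diff]
      rw [DiffPlus.coe_mul_apply, DiffPlus.coe_mul_apply, hinv, h.apply_coe _ hs, hf.apply_coe,
        Real.Angle.coe_sub]
  · set l : ℝ → ℝ := g.diff.logJac with hl
    have hls : ContDiff ℝ ∞ l := g.diff.logJac_contDiff
    have hL := h.contDiffOn_logSlope
    have hLy := contDiffOn_dirDeriv hL hO (0, 1)
    have hlG : ContDiffOn ℝ ∞ (fun q => l (G q)) (J ×ˢ univ) := hls.comp_contDiffOn h.contDiffOn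
    have hl' : ContDiffOn ℝ ∞ (fun q : ℝ × ℝ => deriv l q.2) (J ×ˢ univ) :=
      ((contDiff_deriv hls).comp contDiff_snd).contDiffOn
    set H : ℝ × ℝ → ℝ := fun q => l (G q) * dirDeriv (0, 1) (logSlope G) q
      - (l (G q) + logSlope G q) * deriv l q.2 with hH
    have hHs : ContDiffOn ℝ ∞ H (J ×ˢ univ) := (hlG.mul hLy).sub ((hlG.add hL).mul hl')
    have hHi := contDiffOn_parametric_integral (a := 0) (b := 2 * π) h.isOpen isOpen_univ hHs
      (subset_univ _)
    have hcirc : ∀ s ∈ J, (g * η s * g⁻¹).circ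
        = Circle.exp (θ s + 2 * π * ∫ y in (0 : ℝ)..(2 * π), H (s, y)) := by
      intro s hs
      have e1 : bott g.diff (η s).diff = ∫ y in (0 : ℝ)..(2 * π),
          l (G (s, y)) * dirDeriv (0, 1) (logSlope G) (s, y) := by
        rw [bott_eq_of_isLift (h.isLift hs)]
        simp only [h.deriv_logJac_eq hs, hl]
      have e2 : bott (g.diff * (η s).diff) g.diff⁻¹ = -∫ y in (0 : ℝ)..(2 * π),
          (l (G (s, y)) + logSlope G (s, y)) * deriv l y := by
        rw [bott_inv_right]
        congr 1
        refine intervalIntegral.integral_congr fun y _ => ?_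
        have e3 : g.diff.logJac ((η s).diff.lift y) = g.diff.logJac (G (s, y)) :=
          IsLift.periodic_apply_eq g.diff.logJac_periodic
            (((η s).diff.isLift.apply_coe y).symm.trans (h.apply_coe s hs y))
        simp only [DiffPlus.logJac_mul, e3, h.logJac_eq hs, hl]
      have e4 : ∫ y in (0 : ℝ)..(2 * π), H (s, y)
          = bott g.diff (η s).diff + bott (g.diff * (η s).diff) g.diff⁻¹ := by
        rw [e1, e2, ← sub_eq_add_neg, ← intervalIntegral.integral_sub]
        · exact (continuousOn_slice (hlG.mul hLy).continuousOn hs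
            (subset_univ _)).intervalIntegrable
        · exact (continuousOn_slice ((hlG.add hL).mul hl').continuousOn hs
            (subset_univ _)).intervalIntegrable
      rw [e4, VBGroup.mul_circ, VBGroup.mul_circ, VBGroup.mul_diff, VBGroup.inv_circ,
        VBGroup.inv_diff, h.circ_eq s hs, mul_add, Circle.exp_add, Circle.exp_add]
      generalize Circle.exp (2 * π * bott g.diff (η s).diff) = A
      generalize Circle.exp (2 * π * bott (g.diff * (η s).diff) g.diff⁻¹) = B
      calc g.circ * Circle.exp (θ s) * A * g.circ⁻¹ * B
          = g.circ * g.circ⁻¹ * (Circle.exp (θ s) * (A * B)) := by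
            simp only [mul_assoc, mul_comm, mul_left_comm]
        _ = _ := by rw [mul_inv_cancel, one_mul]
    have hHd (y : ℝ) : dirDeriv (1, 0) H (0, y)
        = l y * Y.1.D.D y - (deriv l y * Y.1 y + Y.1.D y) * deriv l y := by
      have dl : HasDerivAt (fun s => l (G (s, y))) (deriv l (G (0, y)) * Y.1 y) 0 :=
        (((hls.differentiable (by simp)) _).hasDerivAt).comp (0 : ℝ) (hGd y)
      have dL := hasDerivAt_comp_curve (hasDerivAt_mk_left hid y)
        (differentiableAt_of_contDiffOn hL hO (hm y))
      have dLy := hasDerivAt_comp_curve (hasDerivAt_mk_left hid y)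
        (differentiableAt_of_contDiffOn hLy hO (hm y))
      have p1 : l (G (0, y)) = l y :=
        IsLift.periodic_apply_eq g.diff.logJac_periodic (hG.coe_eq y)
      have p2 : deriv l (G (0, y)) = deriv l y :=
        IsLift.periodic_apply_eq (periodic_deriv g.diff.logJac_periodic) (hG.coe_eq y)
      rw [hG.logSlope_dt] at dL
      rw [hG.logSlope_dty] at dLy
      refine (dirDeriv_left_eq (d := _) h.isOpen hHs hid h0
        ((dl.mul dLy).sub ((dl.add dL).mul_const (deriv l y)))).trans ?_
      rw [hG.logSlope_dy, p1, p2]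
      ring
    have hd : HasDerivAt (fun s => θ s + 2 * π * ∫ y in (0 : ℝ)..(2 * π), H (s, y))
        (4 * π * Z.2) 0 := by
      have d1 := hasDerivAt_comp_curve hid
        (differentiableAt_of_contDiffOn h.contDiffOn_circ h.isOpen h0)
      have d2 := hasDerivAt_comp_curve hid (differentiableAt_of_contDiffOn hHi h.isOpen h0)
      refine (d1.add (d2.const_mul (2 * π))).congr_deriv ?_
      rw [dirDeriv_parametric_integral h.isOpen isOpen_univ hHs (subset_univ _) h0, hZ2, hY2]
      simp only [hHd]
      have hpi := Real.pi_pos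
      field_simp
      ring
    refine (hasDerivAt_arg_exp hd ?_).congr_of_eventuallyEq ?_
    · rw [← hcirc 0 h0, hσ0]
      rfl
    · filter_upwards [hJ] with s hs
      rw [hcirc s hs]

theorem dirDeriv_one_eq {f : ℝ × ℝ → ℝ} (r : ℝ) (q : ℝ × ℝ) :
    dirDeriv (1, r) f q = dirDeriv (1, 0) f q + r * dirDeriv (0, 1) f q := by
  unfold dirDeriv
  have : ((1, r) : ℝ × ℝ) = (1, 0) + r • ((0 : ℝ), (1 : ℝ)) := by simp
  rw [this, map_add, map_smul, smul_eq_mul]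

/-- The derivative of the adjoint action is the bracket of the central extension. -/
theorem exists_hasRightLogDeriv_conj (J : Set ℝ) (γ η : ℝ → VBGroup) (X Y : VirAlg)
    (hJ : IsOpen J) (h0 : (0 : ℝ) ∈ J) (hγ : IsSmoothOn γ J) (hη : IsSmoothOn η J)
    (hγ0 : γ 0 = 1) (hη0 : η 0 = 1) (hX : HasRightLogDeriv γ 0 X) (hY : HasRightLogDeriv η 0 Y) :
    ∃ Z : ℝ → VirAlg,
      (∀ t ∈ J, HasRightLogDeriv (fun s => γ t * η s * (γ t)⁻¹) 0 (Z t)) ∧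
      (∀ x : ℝ, HasDerivAt (fun t => (Z t).1 x) (⁅X, Y⁆.1 x) 0) ∧
      HasDerivAt (fun t => (Z t).2) ⁅X, Y⁆.2 0 := by
  obtain ⟨F, θ, hF⟩ := hγ.exists_isSmoothLift hJ
  obtain ⟨G, ϑ, hG⟩ := hη.exists_isSmoothLift hJ
  obtain ⟨hU, -⟩ := hF.liftAtUnit h0 hγ0 hX
  obtain ⟨Ψ, hΨ, hl, hr⟩ := hF.exists_inverse
  have hO := hF.isOpen_prod
  have hm (y : ℝ) : ((0, y) : ℝ × ℝ) ∈ J ×ˢ (univ : Set ℝ) := ⟨h0, mem_univ _⟩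
  have hid : HasDerivAt (fun s : ℝ => s) 1 0 := hasDerivAt_id 0
  have hL := hF.contDiffOn_logSlope
  have hLy := contDiffOn_dirDeriv hL hO (0, 1)
  have hFy := contDiffOn_dirDeriv hF.contDiffOn hO (0, 1)
  have hZ : ∀ t, ∃ Z : VirAlg, t ∈ J →
      (∀ x, Z.1 x = dirDeriv (0, 1) F (t, Ψ (t, x)) * Y.1 (Ψ (t, x))) ∧
      Z.2 = Y.2 + 1 / 2 * ∫ y in (0 : ℝ)..(2 * π), (logSlope F (t, y) * Y.1.D.D y
        - (dirDeriv (0, 1) (logSlope F) (t, y) * Y.1 y + Y.1.D y)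
          * dirDeriv (0, 1) (logSlope F) (t, y)) := by
    intro t
    by_cases ht : t ∈ J
    · have hper (x : ℝ) : Ψ (t, x + 2 * π) = Ψ (t, x) + 2 * π := by
        rw [← hl t ht (Ψ (t, x) + 2 * π), hF.add_two_pi ht, hr t ht]
      refine ⟨(⟨fun x => dirDeriv (0, 1) F (t, Ψ (t, x)) * Y.1 (Ψ (t, x)), ?_, fun x => ?_⟩, _),
        fun _ => ⟨fun x => rfl, rfl⟩⟩
      · have := IsSmoothLift.contDiff_slice hΨ ht
        exact ((IsSmoothLift.contDiff_slice hFy ht).comp this).mul (Y.1.contDiff.comp this)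
      · simp only [hper, Y.1.periodic (Ψ (t, x)),
          dirDeriv_add_period hF.isOpen (fun p hp y => hF.add_two_pi hp y) _ ht]
    · exact ⟨0, fun h => absurd h ht⟩
  choose Z hZ using hZ
  refine ⟨Z, fun t ht => ?_, fun x => ?_, ?_⟩
  · refine hasRightLogDeriv_conj hG h0 hη0 hY (γ t) (hF.isLift ht) (hr t ht) (fun x => ?_) ?_
    · rw [(hZ t ht).1, (hF.hasDerivAt ht _).deriv]
    · rw [(hZ t ht).2]
      simp only [hF.deriv_logJac_eq ht]
      simp only [hF.logJac_eq ht]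
  · set z := Ψ (0, x) with hz
    have hzx : ((z : ℝ) : Real.Angle) = x := by rw [← hU.coe_eq, hr 0 h0]
    -- `Ψ (t, x)` moves with velocity `-X`
    have dΨ : HasDerivAt (fun t => Ψ (t, x)) (-X.1 z) 0 := by
      have d1 := hasDerivAt_comp_curve (hasDerivAt_mk_left hid x)
        (differentiableAt_of_contDiffOn hΨ hO (hm x))
      have d2 := hasDerivAt_comp_curve (hid.prodMk d1)
        (differentiableAt_of_contDiffOn hF.contDiffOn hO (hm z))
      have d3 : HasDerivAt (fun t => F (t, Ψ (t, x))) 0 0 :=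
        (hasDerivAt_const (0 : ℝ) x).congr_of_eventuallyEq (by
          filter_upwards [hJ.mem_nhds h0] with t ht using hr t ht x)
      have e := d2.unique d3
      rw [dirDeriv_one_eq, ← hz, hU.dt, hU.dy] at e
      exact d1.congr_deriv (by linarith)
    have d1 := hasDerivAt_comp_curve (hid.prodMk dΨ)
      (differentiableAt_of_contDiffOn hFy hO (hm z))
    have d2 : HasDerivAt (fun t => Y.1 (Ψ (t, x))) (Y.1.D z * -X.1 z) 0 :=
      (Y.1.hasDerivAt z).comp (0 : ℝ) dΨ
    refine ((d1.mul d2).congr_of_eventuallyEq ?_).congr_deriv ?_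
    · filter_upwards [hJ.mem_nhds h0] with t ht using (hZ t ht).1 x
    · rw [dirDeriv_one_eq, ← hz, hU.dty, hU.dyy, hU.dy, VirAlg.fst_bracket,
        ← IsLift.periodic_apply_eq (X.1.bracket Y.1).periodic hzx, VectS1.bracket_apply]
      ring
  · set H : ℝ × ℝ → ℝ := fun q => logSlope F q * Y.1.D.D q.2
      - (dirDeriv (0, 1) (logSlope F) q * Y.1 q.2 + Y.1.D q.2)
        * dirDeriv (0, 1) (logSlope F) q with hH
    have hs (f : VectS1) : ContDiffOn ℝ ∞ (fun q : ℝ × ℝ => f q.2) (J ×ˢ univ) :=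
      (f.contDiff.comp contDiff_snd).contDiffOn
    have hHs : ContDiffOn ℝ ∞ H (J ×ˢ univ) :=
      (hL.mul (hs _)).sub (((hLy.mul (hs _)).add (hs _)).mul hLy)
    have hHi := contDiffOn_parametric_integral (a := 0) (b := 2 * π) hJ isOpen_univ hHs
      (subset_univ _)
    have hHd (y : ℝ) : dirDeriv (1, 0) H (0, y) = X.1.D y * Y.1.D.D y - Y.1.D y * X.1.D.D y := by
      have dL := hasDerivAt_comp_curve (hasDerivAt_mk_left hid y)
        (differentiableAt_of_contDiffOn hL hO (hm y))
      have dLy := hasDerivAt_comp_curve (hasDerivAt_mk_left hid y)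
        (differentiableAt_of_contDiffOn hLy hO (hm y))
      rw [hU.logSlope_dt] at dL
      rw [hU.logSlope_dty] at dLy
      refine (dirDeriv_left_eq (d := _) hJ hHs hid h0 ((dL.mul_const (Y.1.D.D y)).sub
        (((dLy.mul_const (Y.1 y)).add_const (Y.1.D y)).mul dLy))).trans ?_
      rw [hU.logSlope_dy]
      ring
    have d := ((hasDerivAt_comp_curve hid
      (differentiableAt_of_contDiffOn hHi hJ h0)).const_mul (1 / 2)).const_add Y.2
    refine (d.congr_of_eventuallyEq ?_).congr_deriv ?_
    · filter_upwards [hJ.mem_nhds h0] with t ht using (hZ t ht).2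
    · rw [dirDeriv_parametric_integral hJ isOpen_univ hHs (subset_univ _) h0]
      simp only [hHd]
      rw [intervalIntegral.integral_sub (VectS1.intervalIntegrable_mul _ _ _ _)
        (VectS1.intervalIntegrable_mul _ _ _ _), VirAlg.snd_bracket]
      change 1 / 2 * (omega X.1 Y.1 - omega Y.1 X.1) = _
      rw [omega_swap X.1 Y.1]
      ring

/-! ### The first variation of the energy density -/

section

variable {P : Type} [NormedAddCommGroup P] [NormedSpace ℝ P]

/-- `E = F_vv F_y + 2 F_v F_vy + a (L_vy / F_y)_y`, where `L = log F_y` and `a` is the central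
component of the right logarithmic derivative in the direction `v`: the expression
`u_t + 3 u u_x + a u_xxx` in Lagrangian coordinates, multiplied by `F_y`. -/
noncomputable def lagrangianKdV (F : P × ℝ → ℝ) (θ : P → ℝ) (v : P) (q : P × ℝ) : ℝ :=
  dirDeriv (v, 0) (dirDeriv (v, 0) F) q * dirDeriv (0, 1) F q
    + 2 * dirDeriv (v, 0) F q * dirDeriv (0, 1) (dirDeriv (v, 0) F) q
    + circVelocity F θ v q.1 * dirDeriv (0, 1)
      (fun q => dirDeriv (0, 1) (dirDeriv (v, 0) (logSlope F)) q / dirDeriv (0, 1) F q) q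

/-- Half the squared norm `½ (∫ F_v² F_y dy + a²)` of the velocity in the direction `v`. -/
noncomputable def energyDensity (F : P × ℝ → ℝ) (θ : P → ℝ) (v : P) (p : P) : ℝ :=
  1 / 2 * ((∫ y in (0 : ℝ)..(2 * π), dirDeriv (v, 0) F (p, y) ^ 2 * dirDeriv (0, 1) F (p, y))
    + circVelocity F θ v p ^ 2)

/-- The inner product `∫ F_v F_w F_y dy + a b` of the velocities in the directions `v`
and `w`. -/
noncomputable def velocityInner (F : P × ℝ → ℝ) (θ : P → ℝ) (v w : P) (p : P) : ℝ :=
  (∫ y in (0 : ℝ)..(2 * π), dirDeriv (w, 0) F (p, y) * dirDeriv (v, 0) F (p, y)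
    * dirDeriv (0, 1) F (p, y)) + circVelocity F θ v p * circVelocity F θ w p

namespace IsSmoothLift

variable {Γ : P → VBGroup} {W : Set P} {F : P × ℝ → ℝ} {θ : P → ℝ} {p : P}

theorem intervalIntegrable_slice {f : P × ℝ → ℝ} (hf : ContDiffOn ℝ ∞ f (W ×ˢ univ)) (hp : p ∈ W)
    (a b : ℝ) : IntervalIntegrable (fun y => f (p, y)) volume a b :=
  (contDiff_slice hf hp).continuous.intervalIntegrable a b

theorem logSlope_add_two_pi (h : IsSmoothLift Γ W F θ) (hp : p ∈ W) (y : ℝ) :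
    logSlope F (p, y + 2 * π) = logSlope F (p, y) := by
  unfold logSlope
  rw [dirDeriv_add_period h.isOpen (fun p hp y => h.add_two_pi hp y) _ hp]

theorem dirDeriv_logSlope (h : IsSmoothLift Γ W F θ) {q : P × ℝ} (hq : q ∈ W ×ˢ univ)
    (v : P × ℝ) : dirDeriv v (logSlope F) q
      = dirDeriv (0, 1) (dirDeriv v F) q / dirDeriv (0, 1) F q := by
  rw [← dirDeriv_comm h.contDiffOn h.isOpen_prod hq]
  exact dirDeriv_log (differentiableAt_of_contDiffOn
    (contDiffOn_dirDeriv h.contDiffOn h.isOpen_prod _) h.isOpen_prod hq)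
    (h.dirDeriv_pos hq.1 q.2).ne' v

theorem contDiffOn_logSlope_div (h : IsSmoothLift Γ W F θ) (v : P) : ContDiffOn ℝ ∞
    (fun q => dirDeriv (0, 1) (dirDeriv (v, 0) (logSlope F)) q / dirDeriv (0, 1) F q)
    (W ×ˢ univ) :=
  (contDiffOn_dirDeriv (contDiffOn_dirDeriv h.contDiffOn_logSlope h.isOpen_prod _)
    h.isOpen_prod _).div (contDiffOn_dirDeriv h.contDiffOn h.isOpen_prod _)
    fun q hq => (h.dirDeriv_pos hq.1 q.2).ne'

theorem contDiffOn_kinetic (h : IsSmoothLift Γ W F θ) (v w : P) : ContDiffOn ℝ ∞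
    (fun q => dirDeriv (w, 0) F q * dirDeriv (v, 0) F q * dirDeriv (0, 1) F q) (W ×ˢ univ) :=
  have hd := fun v => contDiffOn_dirDeriv h.contDiffOn h.isOpen_prod v
  ((hd _).mul (hd _)).mul (hd _)

theorem contDiffOn_velocityInner (h : IsSmoothLift Γ W F θ) (v w : P) :
    ContDiffOn ℝ ∞ (velocityInner F θ v w) W :=
  (contDiffOn_parametric_integral h.isOpen isOpen_univ (h.contDiffOn_kinetic v w)
    (subset_univ _)).add ((h.contDiffOn_circVelocity v).mul (h.contDiffOn_circVelocity w))

theorem contDiffOn_energyDensity (h : IsSmoothLift Γ W F θ) (v : P) :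
    ContDiffOn ℝ ∞ (energyDensity F θ v) W :=
  have hd := fun v => contDiffOn_dirDeriv h.contDiffOn h.isOpen_prod v
  contDiffOn_const.mul ((contDiffOn_parametric_integral h.isOpen isOpen_univ
    (((hd (v, 0)).pow 2).mul (hd _)) (subset_univ _)).add ((h.contDiffOn_circVelocity v).pow 2))

/-- The central component of `∂_w X - ∂_v Y = [Y, X]` for the right logarithmic derivatives `X` and
`Y` in the directions `v` and `w`: the integral on the right is that of `X_xxx Y` over the circle,
in Lagrangian coordinates, and equals `-ω(Y, X)`. -/
theorem dirDeriv_circVelocity (h : IsSmoothLift Γ W F θ) (hp : p ∈ W) (v w : P) :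
    dirDeriv w (circVelocity F θ v) p = dirDeriv v (circVelocity F θ w) p
      - ∫ y in (0 : ℝ)..(2 * π), dirDeriv (w, 0) F (p, y) * dirDeriv (0, 1) (fun q =>
        dirDeriv (0, 1) (dirDeriv (v, 0) (logSlope F)) q / dirDeriv (0, 1) F q) (p, y) := by
  have hO := h.isOpen_prod
  have hL := h.contDiffOn_logSlope
  have hF := h.contDiffOn
  set N : P × ℝ → ℝ := fun q =>
    dirDeriv (0, 1) (dirDeriv (v, 0) (logSlope F)) q / dirDeriv (0, 1) F q with hN
  have hNs : ContDiffOn ℝ ∞ N (W ×ˢ univ) := h.contDiffOn_logSlope_div v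
  have hLd := fun v => contDiffOn_dirDeriv hL hO v
  have hFd := fun v => contDiffOn_dirDeriv hF hO v
  have hper := fun v => dirDeriv_add_period (W := W) (G := F) h.isOpen
    (fun p hp y => h.add_two_pi hp y) v hp
  have hLper := fun v p (hp : p ∈ W) => dirDeriv_add_period (W := W) (G := logSlope F) (c := 0)
    h.isOpen (fun p hp y => by rw [h.logSlope_add_two_pi hp, add_zero]) v hp
  have hLLper := fun v w => dirDeriv_add_period (W := W) (G := dirDeriv v (logSlope F)) (c := 0)
    h.isOpen (fun p hp y => by rw [hLper v p hp, add_zero]) w hp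
  -- derivative of the definition in the direction `w`, for the direction `v`
  have key (v w : P) : dirDeriv w (circVelocity F θ v) p
      = dirDeriv w (dirDeriv v θ) p / (4 * π) - 1 / 2 * ∫ y in (0 : ℝ)..(2 * π),
        dirDeriv (w, 0) (fun q => dirDeriv (v, 0) (logSlope F) q
          * dirDeriv (0, 1) (logSlope F) q) (p, y) := by
    have hs := (hLd (v, 0)).mul (hLd (0, 1))
    have hθ := differentiableAt_of_contDiffOn (contDiffOn_dirDeriv h.contDiffOn_circ h.isOpen v)
      h.isOpen hp
    have hi := differentiableAt_of_contDiffOn (contDiffOn_parametric_integral (a := 0)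
      (b := 2 * π) h.isOpen isOpen_univ hs (subset_univ _)) h.isOpen hp
    have hθ' : DifferentiableAt ℝ (fun q => dirDeriv v θ q / (4 * π)) p := by
      simp_rw [div_eq_mul_inv]
      exact hθ.mul_const _
    rw [← dirDeriv_parametric_integral h.isOpen isOpen_univ hs (subset_univ _) hp,
      ← dirDeriv_const_mul hi, ← dirDeriv_div_const hθ, ← dirDeriv_sub hθ' (hi.const_mul _)]
    rfl
  have z1 := integral_dirDeriv_eq_zero (a := 0) (b := 2 * π) h.isOpen
    ((hFd (w, 0)).mul hNs) hp (by
      have e1 := hper (w, 0) 0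
      have e2 := hper (0, 1) 0
      have e3 := hLLper (v, 0) (0, 1) 0
      rw [zero_add] at e1 e2 e3
      simp only [hN, e1, e2, e3])
  have z2 := integral_dirDeriv_eq_zero (a := 0) (b := 2 * π) h.isOpen
    ((hLd (v, 0)).mul (hLd (w, 0))) hp (by
      have e1 := hLper (v, 0) p hp 0
      have e2 := hLper (w, 0) p hp 0
      rw [zero_add] at e1 e2
      simp only [e1, e2])
  have hS1 := (hLd (v, 0)).mul (hLd (0, 1))
  have hS2 := (hLd (w, 0)).mul (hLd (0, 1))
  have i1 := intervalIntegrable_slice (contDiffOn_dirDeriv hS1 hO (w, 0)) hp 0 (2 * π)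
  have i2 := intervalIntegrable_slice (contDiffOn_dirDeriv hS2 hO (v, 0)) hp 0 (2 * π)
  have i3 := intervalIntegrable_slice (contDiffOn_dirDeriv ((hFd (w, 0)).mul hNs) hO (0, 1)) hp
    0 (2 * π)
  have i4 := intervalIntegrable_slice ((hFd (w, 0)).mul (contDiffOn_dirDeriv hNs hO (0, 1))) hp
    0 (2 * π)
  have i5 := intervalIntegrable_slice (contDiffOn_dirDeriv ((hLd (v, 0)).mul (hLd (w, 0))) hO
    (0, 1)) hp 0 (2 * π)
  have hpt : ∀ y, dirDeriv (v, 0) (fun q => dirDeriv (w, 0) (logSlope F) q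
        * dirDeriv (0, 1) (logSlope F) q) (p, y)
      - dirDeriv (w, 0) (fun q => dirDeriv (v, 0) (logSlope F) q
        * dirDeriv (0, 1) (logSlope F) q) (p, y)
      = 2 * (dirDeriv (0, 1) (fun q => dirDeriv (w, 0) F q * N q) (p, y)
        - dirDeriv (w, 0) F (p, y) * dirDeriv (0, 1) N (p, y))
        - dirDeriv (0, 1) (fun q => dirDeriv (v, 0) (logSlope F) q
          * dirDeriv (w, 0) (logSlope F) q) (p, y) := by
    intro y
    have hm : (p, y) ∈ W ×ˢ (univ : Set ℝ) := ⟨hp, mem_univ _⟩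
    have dL := fun v => differentiableAt_of_contDiffOn (hLd v) hO hm
    have dF := fun v => differentiableAt_of_contDiffOn (hFd v) hO hm
    have dN := differentiableAt_of_contDiffOn hNs hO hm
    rw [dirDeriv_mul (dL _) (dL _), dirDeriv_mul (dL _) (dL _), dirDeriv_mul (dL _) (dL _),
      dirDeriv_mul (dF _) dN, dirDeriv_comm hL hO hm (v, 0) (w, 0),
      dirDeriv_comm hL hO hm (v, 0) (0, 1), dirDeriv_comm hL hO hm (w, 0) (0, 1),
      h.dirDeriv_logSlope hm (w, 0)]
    have := (h.dirDeriv_pos hp y).ne'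
    simp only [hN]
    field_simp
    ring
  have hI := intervalIntegral.integral_congr (a := 0) (b := 2 * π) (μ := volume)
    fun y _ => hpt y
  rw [intervalIntegral.integral_sub i2 i1, intervalIntegral.integral_sub ((i3.sub i4).const_mul 2)
    i5, intervalIntegral.integral_const_mul, intervalIntegral.integral_sub i3 i4, z1, z2] at hI
  rw [key v w, key w v, dirDeriv_comm h.contDiffOn_circ h.isOpen hp v w]
  linarith

/-- The contribution of `½ ∫ u² dx` to the first variation. It produces the terms `u_t + 3 u u_x`
of the equation. -/
theorem dirDeriv_kinetic (h : IsSmoothLift Γ W F θ) (hp : p ∈ W) (v w : P) :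
    1 / 2 * dirDeriv w (fun p => ∫ y in (0 : ℝ)..(2 * π),
      dirDeriv (v, 0) F (p, y) ^ 2 * dirDeriv (0, 1) F (p, y)) p
    = dirDeriv v (fun p => ∫ y in (0 : ℝ)..(2 * π),
        dirDeriv (w, 0) F (p, y) * dirDeriv (v, 0) F (p, y) * dirDeriv (0, 1) F (p, y)) p
      - ∫ y in (0 : ℝ)..(2 * π), dirDeriv (w, 0) F (p, y)
        * (dirDeriv (v, 0) (dirDeriv (v, 0) F) (p, y) * dirDeriv (0, 1) F (p, y)
          + 2 * dirDeriv (v, 0) F (p, y) * dirDeriv (0, 1) (dirDeriv (v, 0) F) (p, y)) := by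
  have hO := h.isOpen_prod
  have hF := h.contDiffOn
  have hFd := fun v => contDiffOn_dirDeriv hF hO v
  have hFdd := fun v w => contDiffOn_dirDeriv (hFd v) hO w
  have hper := fun v => dirDeriv_add_period (W := W) (G := F) h.isOpen
    (fun p hp y => h.add_two_pi hp y) v hp 0
  have hs1 := ((hFd (v, 0)).pow 2).mul (hFd (0, 1))
  have hs2 := h.contDiffOn_kinetic v w
  have hs3 := (hFd (w, 0)).mul (((hFdd (v, 0) (v, 0)).mul (hFd (0, 1))).add
    ((contDiffOn_const (c := (2 : ℝ))).mul (hFd (v, 0)) |>.mul (hFdd (v, 0) (0, 1))))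
  have hs4 := ((hFd (v, 0)).pow 2).mul (hFd (w, 0))
  have z := integral_dirDeriv_eq_zero (a := 0) (b := 2 * π) h.isOpen hs4 hp (by
    simp only [zero_add] at hper
    simp only [hper])
  rw [dirDeriv_parametric_integral h.isOpen isOpen_univ hs1 (subset_univ _) hp,
    dirDeriv_parametric_integral h.isOpen isOpen_univ hs2 (subset_univ _) hp]
  have i1 := intervalIntegrable_slice (contDiffOn_dirDeriv hs1 hO (w, 0)) hp 0 (2 * π)
  have i2 := intervalIntegrable_slice (contDiffOn_dirDeriv hs2 hO (v, 0)) hp 0 (2 * π)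
  have i3 := intervalIntegrable_slice hs3 hp 0 (2 * π)
  have i4 := intervalIntegrable_slice (contDiffOn_dirDeriv hs4 hO (0, 1)) hp 0 (2 * π)
  rw [← intervalIntegral.integral_const_mul, ← intervalIntegral.integral_sub i2 i3,
    ← sub_eq_zero, ← intervalIntegral.integral_sub (i1.const_mul _) (i2.sub i3)]
  refine Eq.trans ?_ ((congrArg (1 / 2 * ·) z).trans (mul_zero _))
  simp only [← intervalIntegral.integral_const_mul]
  refine intervalIntegral.integral_congr fun y _ => ?_
  have hm : (p, y) ∈ W ×ˢ (univ : Set ℝ) := ⟨hp, mem_univ _⟩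
  have dF := fun v => differentiableAt_of_contDiffOn (hFd v) hO hm
  have dp := differentiableAt_of_contDiffOn ((hFd (v, 0)).pow 2) hO hm
  have dm := differentiableAt_of_contDiffOn ((hFd (w, 0)).mul (hFd (v, 0))) hO hm
  rw [dirDeriv_mul dp (dF _), dirDeriv_mul dm (dF _), dirDeriv_mul dp (dF _),
    dirDeriv_mul (dF _) (dF _), dirDeriv_pow_two (dF _), dirDeriv_pow_two (dF _),
    dirDeriv_comm hF hO hm (w, 0) (v, 0), dirDeriv_comm hF hO hm (w, 0) (0, 1),
    dirDeriv_comm hF hO hm (v, 0) (0, 1)]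
  ring

/-- The first variation of the energy density: up to a total derivative in the direction `v` it
pairs the variation with the Korteweg–de Vries expression and with the derivative of the central
component. -/
theorem dirDeriv_energyDensity (h : IsSmoothLift Γ W F θ) (hp : p ∈ W) (v w : P) :
    dirDeriv w (energyDensity F θ v) p = dirDeriv v (velocityInner F θ v w) p
      - ((∫ y in (0 : ℝ)..(2 * π), dirDeriv (w, 0) F (p, y) * lagrangianKdV F θ v (p, y))
        + dirDeriv v (circVelocity F θ v) p * circVelocity F θ w p) := by
  have hO := h.isOpen_prod
  have hFd := fun v => contDiffOn_dirDeriv h.contDiffOn hO v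
  have hFdd := fun v w => contDiffOn_dirDeriv (hFd v) hO w
  have hN := contDiffOn_dirDeriv (h.contDiffOn_logSlope_div v) hO (0, 1)
  have dv := differentiableAt_of_contDiffOn (h.contDiffOn_circVelocity v) h.isOpen hp
  have dw := differentiableAt_of_contDiffOn (h.contDiffOn_circVelocity w) h.isOpen hp
  have d1 := differentiableAt_of_contDiffOn (contDiffOn_parametric_integral (a := 0)
    (b := 2 * π) h.isOpen isOpen_univ (((hFd (v, 0)).pow 2).mul (hFd (0, 1)))
    (subset_univ _)) h.isOpen hp
  have d2 := differentiableAt_of_contDiffOn (contDiffOn_parametric_integral (a := 0)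
    (b := 2 * π) h.isOpen isOpen_univ (h.contDiffOn_kinetic v w) (subset_univ _)) h.isOpen hp
  have e1 : dirDeriv w (energyDensity F θ v) p = 1 / 2 * dirDeriv w (fun p =>
        ∫ y in (0 : ℝ)..(2 * π), dirDeriv (v, 0) F (p, y) ^ 2 * dirDeriv (0, 1) F (p, y)) p
      + circVelocity F θ v p * dirDeriv w (circVelocity F θ v) p := by
    have dp : DifferentiableAt ℝ (fun p => circVelocity F θ v p ^ 2) p := dv.pow 2
    unfold energyDensity
    rw [dirDeriv_const_mul (d1.fun_add dp), dirDeriv_add d1 dp, dirDeriv_pow_two dv]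
    ring
  have e2 : dirDeriv v (velocityInner F θ v w) p = dirDeriv v (fun p => ∫ y in (0 : ℝ)..(2 * π),
        dirDeriv (w, 0) F (p, y) * dirDeriv (v, 0) F (p, y) * dirDeriv (0, 1) F (p, y)) p
      + (dirDeriv v (circVelocity F θ v) p * circVelocity F θ w p
        + circVelocity F θ v p * dirDeriv v (circVelocity F θ w) p) := by
    unfold velocityInner
    rw [dirDeriv_add d2 (dv.fun_mul dw), dirDeriv_mul dv dw]
  have e3 : (∫ y in (0 : ℝ)..(2 * π), dirDeriv (w, 0) F (p, y) * lagrangianKdV F θ v (p, y))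
      = (∫ y in (0 : ℝ)..(2 * π), dirDeriv (w, 0) F (p, y)
        * (dirDeriv (v, 0) (dirDeriv (v, 0) F) (p, y) * dirDeriv (0, 1) F (p, y)
          + 2 * dirDeriv (v, 0) F (p, y) * dirDeriv (0, 1) (dirDeriv (v, 0) F) (p, y)))
        + circVelocity F θ v p * ∫ y in (0 : ℝ)..(2 * π), dirDeriv (w, 0) F (p, y)
          * dirDeriv (0, 1) (fun q => dirDeriv (0, 1) (dirDeriv (v, 0) (logSlope F)) q
            / dirDeriv (0, 1) F q) (p, y) := by
    have hs3 := (hFd (w, 0)).mul (((hFdd (v, 0) (v, 0)).mul (hFd (0, 1))).add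
      ((contDiffOn_const (c := (2 : ℝ))).mul (hFd (v, 0)) |>.mul (hFdd (v, 0) (0, 1))))
    rw [← intervalIntegral.integral_const_mul, ← intervalIntegral.integral_add
      (intervalIntegrable_slice hs3 hp 0 (2 * π))
      ((intervalIntegrable_slice ((hFd (w, 0)).mul hN) hp 0 (2 * π)).const_mul _)]
    refine intervalIntegral.integral_congr fun y _ => ?_
    simp only [lagrangianKdV]
    ring
  rw [e1, e2, e3, h.dirDeriv_kinetic hp, h.dirDeriv_circVelocity hp v w]
  ring

end IsSmoothLift

end

/-! ### Eulerian coordinates -/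

theorem integral_comp_isLift {f g : ℝ → ℝ} {φ : Equiv.Perm Real.Angle} (hf : IsLift f φ)
    (hg : Continuous g) (hp : Function.Periodic g (2 * π)) :
    ∫ y in (0 : ℝ)..(2 * π), g (f y) * deriv f y = ∫ x in (0 : ℝ)..(2 * π), g x := by
  have h := intervalIntegral.integral_comp_mul_deriv (a := 0) (b := 2 * π) (f := f)
    (f' := deriv f) (g := g) (fun x _ => hf.hasDerivAt x)
    (contDiff_deriv hf.contDiff).continuous.continuousOn hg
  have e : f (2 * π) = f 0 + 2 * π := by simpa using hf.add_two_pi 0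
  simp only [Function.comp_def] at h
  rw [h, e, hp.intervalIntegral_add_eq (f 0) 0, zero_add]

section

variable {P : Type} [NormedAddCommGroup P] [NormedSpace ℝ P]

/-- The expression `∂_v U + 3 U U_x + a U_xxx`. -/
noncomputable def eulerianKdV (U : P × ℝ → ℝ) (a : ℝ) (v : P) (q : P × ℝ) : ℝ :=
  dirDeriv (v, 0) U q + 3 * U q * dirDeriv (0, 1) U q
    + a * dirDeriv (0, 1) (dirDeriv (0, 1) (dirDeriv (0, 1) U)) q

/-- `U` is the Eulerian velocity in the direction `v` of the family with lift `F`. -/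
structure IsEulerianVelocity (W : Set P) (F : P × ℝ → ℝ) (v : P) (U : P × ℝ → ℝ) : Prop where
  contDiffOn : ContDiffOn ℝ ∞ U (W ×ˢ univ)
  apply_lift : ∀ p ∈ W, ∀ y, U (p, F (p, y)) = dirDeriv (v, 0) F (p, y)

namespace IsSmoothLift

variable {Γ : P → VBGroup} {W : Set P} {F : P × ℝ → ℝ} {θ : P → ℝ} {p : P} {U : P × ℝ → ℝ} {v : P}

theorem exists_isEulerianVelocity [CompleteSpace P] (h : IsSmoothLift Γ W F θ) (v : P) :
    ∃ U, IsEulerianVelocity W F v U := by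
  obtain ⟨Ψ, hΨ, hl, -⟩ := h.exists_inverse
  refine ⟨fun q => dirDeriv (v, 0) F (q.1, Ψ q), ?_, fun p hp y => ?_⟩
  · exact (contDiffOn_dirDeriv h.contDiffOn h.isOpen_prod _).comp
      (contDiff_fst.contDiffOn.prodMk hΨ) fun q hq => ⟨hq.1, mem_univ _⟩
  · simp only [hl p hp]

theorem dirDeriv_comp_lift (h : IsSmoothLift Γ W F θ) {f : P × ℝ → ℝ}
    (hf : ContDiffOn ℝ ∞ f (W ×ˢ univ)) {q : P × ℝ} (hq : q ∈ W ×ˢ univ) (z : P × ℝ) :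
    dirDeriv z (fun q => f (q.1, F q)) q
      = dirDeriv (z.1, 0) f (q.1, F q) + dirDeriv z F q * dirDeriv (0, 1) f (q.1, F q) := by
  have hF := (differentiableAt_of_contDiffOn h.contDiffOn h.isOpen_prod hq).hasFDerivAt
  have hfd := (differentiableAt_of_contDiffOn (x := (q.1, F q)) hf h.isOpen_prod
    ⟨hq.1, mem_univ _⟩).hasFDerivAt
  have hΦ : HasFDerivAt (fun q : P × ℝ => (q.1, F q)) _ q := hasFDerivAt_fst.prodMk hF
  have e : HasFDerivAt (fun q => f (q.1, F q)) _ q := hfd.comp q hΦ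
  unfold dirDeriv
  rw [e.fderiv]
  simp only [ContinuousLinearMap.comp_apply, ContinuousLinearMap.prod_apply,
    ContinuousLinearMap.coe_fst']
  have hsplit : ((z.1, fderiv ℝ F q z) : P × ℝ)
      = (z.1, 0) + (fderiv ℝ F q z) • ((0 : P), (1 : ℝ)) := by simp
  rw [hsplit, map_add, map_smul, smul_eq_mul]

/-- The Lagrangian and the Eulerian form of the Korteweg–de Vries expression agree. -/
theorem lagrangianKdV_eq (h : IsSmoothLift Γ W F θ) (hU : IsEulerianVelocity W F v U)
    (hp : p ∈ W) (y : ℝ) : lagrangianKdV F θ v (p, y)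
      = eulerianKdV U (circVelocity F θ v p) v (p, F (p, y)) * dirDeriv (0, 1) F (p, y) := by
  have hO := h.isOpen_prod
  have hm : (p, y) ∈ W ×ˢ (univ : Set ℝ) := ⟨hp, mem_univ _⟩
  have hU1 := contDiffOn_dirDeriv hU.contDiffOn hO (0, 1)
  have hU2 := contDiffOn_dirDeriv hU1 hO (0, 1)
  have hdy : ∀ {f : P × ℝ → ℝ}, ContDiffOn ℝ ∞ f (W ×ˢ univ) → ∀ q ∈ W ×ˢ (univ : Set ℝ),
      dirDeriv (0, 1) (fun q => f (q.1, F q)) q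
        = dirDeriv (0, 1) F q * dirDeriv (0, 1) f (q.1, F q) := fun {f} hf q hq => by
    rw [h.dirDeriv_comp_lift hf hq]
    have : dirDeriv ((0 : P), (0 : ℝ)) f (q.1, F q) = 0 := map_zero _
    simp only [this, zero_add]
  have eF : EqOn (dirDeriv (v, 0) F) (fun q => U (q.1, F q)) (W ×ˢ univ) := fun q hq =>
    (hU.apply_lift q.1 hq.1 q.2).symm
  have hne := fun (q : P × ℝ) (hq : q ∈ W ×ˢ (univ : Set ℝ)) => (h.dirDeriv_pos hq.1 q.2).ne'
  -- `L_v = u_x ∘ F` and `L_vy / F_y = u_xx ∘ F`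
  have eL : EqOn (dirDeriv (v, 0) (logSlope F)) (fun q => dirDeriv (0, 1) U (q.1, F q))
      (W ×ˢ univ) := fun q hq => by
    have := hne q hq
    simp only
    rw [h.dirDeriv_logSlope hq, dirDeriv_congr hO eF hq, hdy hU.contDiffOn q hq]
    field_simp
  have eN : EqOn (fun q => dirDeriv (0, 1) (dirDeriv (v, 0) (logSlope F)) q / dirDeriv (0, 1) F q)
      (fun q => dirDeriv (0, 1) (dirDeriv (0, 1) U) (q.1, F q)) (W ×ˢ univ) := fun q hq => by
    have := hne q hq
    simp only
    rw [dirDeriv_congr hO eL hq, hdy hU1 q hq]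
    field_simp
  unfold lagrangianKdV eulerianKdV
  rw [dirDeriv_congr hO eN hm, hdy hU2 _ hm, dirDeriv_congr hO eF hm (v, 0),
    h.dirDeriv_comp_lift hU.contDiffOn hm, dirDeriv_congr hO eF hm (0, 1),
    hdy hU.contDiffOn _ hm, eF hm]
  ring

section curve

variable {c : ℝ → P} {t : ℝ} {γ : ℝ → VBGroup}

theorem rightLogDeriv_fst [CompleteSpace P] (h : IsSmoothLift Γ W F θ)
    (hU : IsEulerianVelocity W F v U) (hc : HasDerivAt c v t) (hp : c t ∈ W)
    (hγ : ∀ᶠ τ in 𝓝 t, γ τ = Γ (c τ)) (x : ℝ) : (rightLogDeriv γ t).1 x = U (c t, x) := by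
  obtain ⟨y, rfl⟩ := (h.isLift hp).surjective x
  rw [(h.rightLogDeriv_spec hc hp hγ).2.1, hU.apply_lift _ hp]

theorem eventually_curve (h : IsSmoothLift Γ W F θ) (hc : HasDerivAt c v t) (hp : c t ∈ W)
    (hγ : ∀ᶠ τ in 𝓝 t, γ τ = Γ (c τ)) :
    ∀ᶠ τ in 𝓝 t, c τ ∈ W ∧ ∀ᶠ τ' in 𝓝 τ, γ τ' = Γ (c τ') :=
  (hc.continuousAt.eventually_mem (h.isOpen.mem_nhds hp)).and hγ.eventually_nhds

/-- The Korteweg–de Vries expression of the right logarithmic derivative. -/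
theorem kdv_rightLogDeriv [CompleteSpace P] (h : IsSmoothLift Γ W F θ)
    (hU : IsEulerianVelocity W F v U) (hc : ∀ τ, HasDerivAt c v τ) (hp : c t ∈ W)
    (hγ : ∀ᶠ τ in 𝓝 t, γ τ = Γ (c τ)) (a x : ℝ) :
    deriv (fun τ => (rightLogDeriv γ τ).1 x) t
      + 3 * (rightLogDeriv γ t).1 x * deriv (rightLogDeriv γ t).1 x
      + a * iteratedDeriv 3 (rightLogDeriv γ t).1 x = eulerianKdV U a v (c t, x) := by
  have hO := h.isOpen_prod
  have hU1 := contDiffOn_dirDeriv hU.contDiffOn hO (0, 1)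
  have hU2 := contDiffOn_dirDeriv hU1 hO (0, 1)
  have e0 := h.rightLogDeriv_fst hU (hc t) hp hγ
  have e1 (x : ℝ) := dirDeriv_right_eq h.isOpen hU.contDiffOn hp (fun y => (e0 y).symm)
    ((rightLogDeriv γ t).1.hasDerivAt x)
  have e2 (x : ℝ) := dirDeriv_right_eq h.isOpen hU1 hp e1 ((rightLogDeriv γ t).1.D.hasDerivAt x)
  have e3 (x : ℝ) := dirDeriv_right_eq h.isOpen hU2 hp e2
    ((rightLogDeriv γ t).1.D.D.hasDerivAt x)
  have et : deriv (fun τ => (rightLogDeriv γ τ).1 x) t = dirDeriv (v, 0) U (c t, x) := by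
    refine HasDerivAt.deriv ((hasDerivAt_comp_curve (hasDerivAt_mk_left (hc t) x)
      (differentiableAt_of_contDiffOn hU.contDiffOn hO ⟨hp, mem_univ _⟩)).congr_of_eventuallyEq ?_)
    filter_upwards [h.eventually_curve (hc t) hp hγ] with τ hτ
    exact h.rightLogDeriv_fst hU (hc τ) hτ.1 hτ.2 x
  unfold eulerianKdV
  rw [iteratedDeriv_three, et, e1, e3, e0]
  rfl

theorem hasDerivAt_rightLogDeriv_snd [CompleteSpace P] (h : IsSmoothLift Γ W F θ)
    (hc : ∀ τ, HasDerivAt c v τ) (hp : c t ∈ W) (hγ : ∀ᶠ τ in 𝓝 t, γ τ = Γ (c τ)) :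
    HasDerivAt (fun τ => (rightLogDeriv γ τ).2) (dirDeriv v (circVelocity F θ v) (c t)) t := by
  refine (hasDerivAt_comp_curve (hc t) (differentiableAt_of_contDiffOn
    (h.contDiffOn_circVelocity v) h.isOpen hp)).congr_of_eventuallyEq ?_
  filter_upwards [h.eventually_curve (hc t) hp hγ] with τ hτ
  exact (h.rightLogDeriv_spec (hc τ) hτ.1 hτ.2).2.2

theorem l2Inner_rightLogDeriv [CompleteSpace P] (h : IsSmoothLift Γ W F θ)
    (hc : HasDerivAt c v t) (hp : c t ∈ W) (hγ : ∀ᶠ τ in 𝓝 t, γ τ = Γ (c τ)) :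
    1 / 2 * l2Inner (rightLogDeriv γ t) (rightLogDeriv γ t) = energyDensity F θ v (c t) := by
  obtain ⟨-, h1, h2⟩ := h.rightLogDeriv_spec hc hp hγ
  set X := rightLogDeriv γ t
  have hX : Function.Periodic (fun x => X.1 x * X.1 x) (2 * π) := fun x => by
    simp only [X.1.periodic x]
  unfold l2Inner energyDensity
  rw [← integral_comp_isLift (g := fun x => X.1 x * X.1 x) (h.isLift hp)
    (X.1.continuous.mul X.1.continuous) hX, h2]
  simp only [h1, (h.hasDerivAt hp _).deriv]
  ring_nf

end curve

end IsSmoothLift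

end

/-! ### The first variation of the energy -/

theorem hasRightLogDeriv_const (g : VBGroup) (t : ℝ) : HasRightLogDeriv (fun _ => g) t 0 := by
  have e (x : ℝ) : ((1 : VBGroup).diff (x : Real.Angle) - (x : Real.Angle)).toReal = 0 := by
    have : (1 : VBGroup).diff (x : Real.Angle) = (x : Real.Angle) := rfl
    rw [this, sub_self, Real.Angle.toReal_zero]
  unfold HasRightLogDeriv
  simp only [mul_inv_cancel, e]
  exact ⟨fun x => hasDerivAt_const _ _, by simpa using hasDerivAt_const t (0 : ℝ)⟩

section

variable {J K : Set ℝ} {Γ : ℝ × ℝ → VBGroup} {F : (ℝ × ℝ) × ℝ → ℝ} {θ : ℝ × ℝ → ℝ}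

theorem hasDerivAt_line_left (s τ : ℝ) : HasDerivAt (fun τ : ℝ => (τ, s)) ((1 : ℝ), (0 : ℝ)) τ :=
  (hasDerivAt_id τ).prodMk (hasDerivAt_const τ s)

theorem hasDerivAt_line_right (t τ : ℝ) : HasDerivAt (fun s : ℝ => (t, s)) ((0 : ℝ), (1 : ℝ)) τ :=
  (hasDerivAt_const τ t).prodMk (hasDerivAt_id τ)

namespace IsSmoothLift

/-- A variation with a fixed end point has vanishing variational velocity there. -/
theorem velocity_eq_zero_of_fixed (h : IsSmoothLift Γ (J ×ˢ K) F θ) (hK : IsOpen K)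
    {t : ℝ} (ht : t ∈ J) (h0 : (0 : ℝ) ∈ K) {g : VBGroup} (hg : ∀ s ∈ K, Γ (t, s) = g) :
    (∀ y, dirDeriv ((0, 1), 0) F ((t, 0), y) = 0) ∧ circVelocity F θ (0, 1) (t, 0) = 0 := by
  obtain ⟨h1, h2, h3⟩ := h.rightLogDeriv_spec (γ := fun _ => g) (c := fun s => (t, s)) (t := 0)
    (hasDerivAt_line_right t 0) ⟨ht, h0⟩
    (by filter_upwards [hK.mem_nhds h0] with s hs using (hg s hs).symm)
  rw [(hasRightLogDeriv_const g 0).rightLogDeriv_eq] at h2 h3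
  exact ⟨fun y => (h2 y).symm, h3.symm⟩

/-- The first variation of the energy for variations with fixed end points. -/
theorem hasDerivAt_energy (h : IsSmoothLift Γ (J ×ˢ K) F θ) (hJ : IsOpen J) (hK : IsOpen K)
    {a b : ℝ} (hab : a < b) (hJab : Icc a b ⊆ J) (h0 : (0 : ℝ) ∈ K) {g₀ g₁ : VBGroup}
    (hfix : ∀ s ∈ K, Γ (a, s) = g₀ ∧ Γ (b, s) = g₁) :
    HasDerivAt (fun s => energy (fun t => Γ (t, s)) a b)
      (-∫ t in a..b, ((∫ y in (0 : ℝ)..(2 * π), dirDeriv ((0, 1), 0) F ((t, 0), y)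
          * lagrangianKdV F θ (1, 0) ((t, 0), y))
        + dirDeriv (1, 0) (circVelocity F θ (1, 0)) (t, 0) * circVelocity F θ (0, 1) (t, 0))) 0 := by
  have huIcc : uIcc a b = Icc a b := uIcc_of_le hab.le
  have hsub : uIcc a b ⊆ J := by rw [huIcc]; exact hJab
  set ρ := energyDensity F θ ((1 : ℝ), (0 : ℝ)) with hρ
  set S := velocityInner F θ ((1 : ℝ), (0 : ℝ)) ((0 : ℝ), (1 : ℝ)) with hS
  have hρs : ContDiffOn ℝ ∞ ρ (J ×ˢ K) := h.contDiffOn_energyDensity _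
  have hSs : ContDiffOn ℝ ∞ S (J ×ˢ K) := h.contDiffOn_velocityInner _ _
  have hO : IsOpen (J ×ˢ K) := hJ.prod hK
  have hρ' : ContDiffOn ℝ ∞ (fun q : ℝ × ℝ => ρ (q.2, q.1)) (K ×ˢ J) :=
    hρs.comp (contDiff_snd.prodMk contDiff_fst).contDiffOn fun q hq => ⟨hq.2, hq.1⟩
  have henergy : ∀ s ∈ K, energy (fun t => Γ (t, s)) a b = ∫ t in a..b, ρ (t, s) := by
    intro s hs
    unfold energy
    rw [← intervalIntegral.integral_const_mul]
    refine intervalIntegral.integral_congr fun t ht => ?_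
    exact h.l2Inner_rightLogDeriv (c := fun t => (t, s)) (hasDerivAt_line_left s t)
      ⟨hsub ht, hs⟩ (Filter.Eventually.of_forall fun _ => rfl)
  have hd := hasDerivAt_comp_curve (c := fun s : ℝ => s) (hasDerivAt_id 0)
    (differentiableAt_of_contDiffOn (contDiffOn_parametric_integral hK hJ hρ' hsub) hK h0)
  refine (hd.congr_of_eventuallyEq (by
    filter_upwards [hK.mem_nhds h0] with s hs using henergy s hs)).congr_deriv ?_
  rw [dirDeriv_parametric_integral hK hJ hρ' hsub h0]
  have hpt : ∀ t ∈ uIcc a b, dirDeriv ((1 : ℝ), (0 : ℝ)) (fun q : ℝ × ℝ => ρ (q.2, q.1)) (0, t)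
      = dirDeriv (1, 0) S (t, 0) - ((∫ y in (0 : ℝ)..(2 * π), dirDeriv ((0, 1), 0) F ((t, 0), y)
          * lagrangianKdV F θ (1, 0) ((t, 0), y))
        + dirDeriv (1, 0) (circVelocity F θ (1, 0)) (t, 0) * circVelocity F θ (0, 1) (t, 0)) := by
    intro t ht
    rw [← h.dirDeriv_energyDensity ⟨hsub ht, h0⟩]
    have d1 := hasDerivAt_comp_curve (hasDerivAt_line_left t 0)
      (differentiableAt_of_contDiffOn (x := ((0 : ℝ), t)) hρ' (hK.prod hJ) ⟨h0, hsub ht⟩)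
    have d2 := hasDerivAt_comp_curve (hasDerivAt_line_right t 0)
      (differentiableAt_of_contDiffOn (x := (t, (0 : ℝ))) hρs hO ⟨hsub ht, h0⟩)
    exact d1.unique d2
  have hmaps : MapsTo (fun t : ℝ => (t, (0 : ℝ))) (uIcc a b) (J ×ˢ K) := fun t ht =>
    ⟨hsub ht, h0⟩
  have hcont : ContinuousOn (fun t : ℝ => (t, (0 : ℝ))) (uIcc a b) := by fun_prop
  have cS : ContinuousOn (fun t : ℝ => dirDeriv (1, 0) S (t, 0)) (uIcc a b) :=
    (contDiffOn_dirDeriv hSs hO _).continuousOn.comp hcont hmaps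
  have cρ : ContinuousOn (fun t : ℝ => dirDeriv (0, 1) ρ (t, 0)) (uIcc a b) :=
    (contDiffOn_dirDeriv hρs hO _).continuousOn.comp hcont hmaps
  have hi : IntervalIntegrable (fun t => (∫ y in (0 : ℝ)..(2 * π),
      dirDeriv ((0, 1), 0) F ((t, 0), y) * lagrangianKdV F θ (1, 0) ((t, 0), y))
        + dirDeriv (1, 0) (circVelocity F θ (1, 0)) (t, 0) * circVelocity F θ (0, 1) (t, 0))
      volume a b := by
    refine ((cS.sub cρ).congr fun t ht => ?_).intervalIntegrable
    rw [Pi.sub_apply, h.dirDeriv_energyDensity ⟨hsub ht, h0⟩]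
    ring
  have hFTC : ∫ t in a..b, dirDeriv (1, 0) S (t, 0) = 0 := by
    rw [intervalIntegral.integral_eq_sub_of_hasDerivAt (f := fun t => S (t, 0))
      (fun t ht => hasDerivAt_comp_curve (hasDerivAt_line_left 0 t)
        (differentiableAt_of_contDiffOn hSs hO (hmaps ht))) cS.intervalIntegrable]
    obtain ⟨u0, v0⟩ := h.velocity_eq_zero_of_fixed hK (hJab (left_mem_Icc.2 hab.le)) h0
      fun s hs => (hfix s hs).1
    obtain ⟨u1, v1⟩ := h.velocity_eq_zero_of_fixed hK (hJab (right_mem_Icc.2 hab.le)) h0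
      fun s hs => (hfix s hs).2
    simp [hS, velocityInner, u0, v0, u1, v1]
  rw [intervalIntegral.integral_congr hpt, intervalIntegral.integral_sub cS.intervalIntegrable hi,
    hFTC, zero_sub]

end IsSmoothLift

end

/-! ### Geodesics and the Korteweg–de Vries equation -/

theorem integral_eq_zero_of_Ioo {f : ℝ → ℝ} {a b : ℝ} (hab : a ≤ b) (h : ∀ t ∈ Ioo a b, f t = 0) :
    ∫ t in a..b, f t = 0 := by
  rw [intervalIntegral.integral_of_le hab, integral_Ioc_eq_integral_Ioo]
  exact setIntegral_eq_zero_of_forall_eq_zero h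

theorem eq_zero_on_Icc_of_Ioo {f : ℝ → ℝ} {a b : ℝ} (hab : a < b) (hf : ContinuousOn f (Icc a b))
    (h : ∀ t ∈ Ioo a b, f t = 0) : ∀ t ∈ Icc a b, f t = 0 :=
  EqOn.of_subset_closure (g := fun _ => 0) h hf continuousOn_const Ioo_subset_Icc_self
    (by rw [closure_Ioo hab.ne])

theorem eq_zero_of_integral_bump_mul_eq_zero {f : ℝ → ℝ} {a b : ℝ} (hab : a < b)
    (hf : ContinuousOn f (Icc a b)) (hf0 : ∀ t ∈ Icc a b, 0 ≤ f t)
    (h : ∫ t in a..b, (t - a) * (b - t) * f t = 0) : ∀ t ∈ Icc a b, f t = 0 := by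
  refine eq_zero_on_Icc_of_Ioo hab hf fun t ht => ?_
  by_contra hcon
  have hpos := lt_of_le_of_ne (hf0 t (Ioo_subset_Icc_self ht)) (Ne.symm hcon)
  have := intervalIntegral.integral_pos (f := fun t => (t - a) * (b - t) * f t) hab
    (ContinuousOn.mul (by fun_prop) hf)
    (fun x hx => mul_nonneg (mul_nonneg (by linarith [hx.1]) (by linarith [hx.2]))
      (hf0 x (Ioc_subset_Icc_self hx)))
    ⟨t, Ioo_subset_Icc_self ht,
      mul_pos (mul_pos (by linarith [ht.1]) (by linarith [ht.2])) hpos⟩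
  linarith

theorem isGeodesicOn_of_kdv {t₀ t₁ : ℝ} {γ : ℝ → VBGroup} (h01 : t₀ < t₁) {a : ℝ}
    (hγ : ∀ t ∈ Icc t₀ t₁, (rightLogDeriv γ t).2 = a ∧ ∀ x : ℝ,
      deriv (fun τ => (rightLogDeriv γ τ).1 x) t
        + 3 * (rightLogDeriv γ t).1 x * deriv (rightLogDeriv γ t).1 x
        + a * iteratedDeriv 3 (rightLogDeriv γ t).1 x = 0) : IsGeodesicOn γ t₀ t₁ := by
  intro J K Γ hJ hK hIJ h0 hΓ hΓ0 hfix
  obtain ⟨F, θ, h⟩ := hΓ.exists_isSmoothLift (hJ.prod hK)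
  obtain ⟨U, hU⟩ := h.exists_isEulerianVelocity (1, 0)
  refine (h.hasDerivAt_energy hJ hK h01 hIJ h0 hfix).congr_deriv ?_
  rw [neg_eq_zero]
  refine integral_eq_zero_of_Ioo h01.le fun t ht => ?_
  have htI := Ioo_subset_Icc_self ht
  have hp : ((t, 0) : ℝ × ℝ) ∈ J ×ˢ K := ⟨hIJ htI, h0⟩
  have hIcc : ∀ᶠ τ in 𝓝 t, τ ∈ Icc t₀ t₁ := Icc_mem_nhds ht.1 ht.2
  have hev : ∀ᶠ τ in 𝓝 t, γ τ = Γ (τ, 0) := hIcc.mono fun τ hτ => (hΓ0 τ hτ).symm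
  have ha : circVelocity F θ (1, 0) (t, 0) = a := by
    rw [← (hγ t htI).1]
    exact (h.rightLogDeriv_spec (c := fun τ => (τ, 0)) (hasDerivAt_line_left 0 t) hp hev).2.2.symm
  have hE (y : ℝ) : lagrangianKdV F θ (1, 0) ((t, 0), y) = 0 := by
    rw [h.lagrangianKdV_eq hU hp, ha, ← h.kdv_rightLogDeriv (c := fun τ => (τ, 0)) hU
      (hasDerivAt_line_left 0) hp hev, (hγ t htI).2, zero_mul]
  have ha' : dirDeriv (1, 0) (circVelocity F θ (1, 0)) (t, 0) = 0 :=
    (h.hasDerivAt_rightLogDeriv_snd (c := fun τ => (τ, 0)) (hasDerivAt_line_left 0) hp hev).unique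
      ((hasDerivAt_const t a).congr_of_eventuallyEq (hIcc.mono fun τ hτ => (hγ τ hτ).1))
  simp [hE, ha']

/-- The Euler–Lagrange equation of a geodesic, tested on the variation with lifts `F + s w` and
`θ + s β`. The central component `b` of the variational velocity is needed only where `w`
vanishes. -/
theorem IsGeodesicOn.euler_lagrange {J : Set ℝ} {t₀ t₁ : ℝ} {γ : ℝ → VBGroup} {F : ℝ × ℝ → ℝ}
    {θ : ℝ → ℝ} {U : ℝ × ℝ → ℝ} (hgeo : IsGeodesicOn γ t₀ t₁) (h01 : t₀ < t₁)
    (hIJ : Icc t₀ t₁ ⊆ J) (h : IsSmoothLift γ J F θ) (hU : IsEulerianVelocity J F 1 U)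
    {w : ℝ × ℝ → ℝ} {β : ℝ → ℝ} (hw : ContDiffOn ℝ ∞ w (J ×ˢ univ)) (hβ : ContDiffOn ℝ ∞ β J)
    (hwp : ∀ t ∈ J, ∀ y, w (t, y + 2 * π) = w (t, y)) (hw0 : ∀ y, w (t₀, y) = 0)
    (hw1 : ∀ y, w (t₁, y) = 0) (hβ0 : β t₀ = 0) (hβ1 : β t₁ = 0) :
    ∃ b : ℝ → ℝ, (∀ t ∈ Icc t₀ t₁, (∀ y, w (t, y) = 0) → b t = β t / (4 * π)) ∧
      ∫ t in t₀..t₁, ((∫ y in (0 : ℝ)..(2 * π), w (t, y)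
          * (eulerianKdV U (circVelocity F θ 1 t) 1 (t, F (t, y)) * dirDeriv (0, 1) F (t, y)))
        + dirDeriv 1 (circVelocity F θ 1) t * b t) = 0 := by
  obtain ⟨C, hC, hIC, hCJ⟩ := exists_compact_between isCompact_Icc h.isOpen hIJ
  have hJ₁ : IsOpen (interior C) := isOpen_interior
  have hJ₁J : interior C ⊆ J := interior_subset.trans hCJ
  have hFy := contDiffOn_dirDeriv h.contDiffOn h.isOpen_prod (0, 1)
  have hwy := contDiffOn_dirDeriv hw h.isOpen_prod (0, 1)
  obtain ⟨K, hK, h0K, hpos⟩ := exists_perturbation_pos h.isOpen hFy.continuousOn hwy.continuousOn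
    hC hCJ (fun t ht y => h.dirDeriv_pos (hCJ ht) y)
    (fun t ht y => dirDeriv_add_period h.isOpen (fun p hp y => h.add_two_pi hp y) _ (hCJ ht) y)
    (fun t ht y => dirDeriv_add_period (c := 0) h.isOpen
      (fun p hp y => by rw [hwp p hp, add_zero]) _ (hCJ ht) y)
  have hO : IsOpen (interior C ×ˢ K) := hJ₁.prod hK
  set G : (ℝ × ℝ) × ℝ → ℝ := fun q => F (q.1.1, q.2) + q.1.2 * w (q.1.1, q.2) with hG
  set ϑ : ℝ × ℝ → ℝ := fun p => θ p.1 + p.2 * β p.1 with hϑ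
  have hproj : ContDiffOn ℝ ∞ (fun q : (ℝ × ℝ) × ℝ => (q.1.1, q.2))
      ((interior C ×ˢ K) ×ˢ univ) := by fun_prop
  have hmaps : MapsTo (fun q : (ℝ × ℝ) × ℝ => (q.1.1, q.2)) ((interior C ×ˢ K) ×ˢ univ)
      (J ×ˢ univ) := fun q hq => ⟨hJ₁J hq.1.1, mem_univ _⟩
  have hGs : ContDiffOn ℝ ∞ G ((interior C ×ˢ K) ×ˢ univ) :=
    (h.contDiffOn.comp hproj hmaps).add
      (ContDiffOn.mul (by fun_prop) (hw.comp hproj hmaps))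
  have hm1 : MapsTo (fun p : ℝ × ℝ => p.1) (interior C ×ˢ K) J := fun p hp => hJ₁J hp.1
  have hϑs : ContDiffOn ℝ ∞ ϑ (interior C ×ˢ K) :=
    (h.contDiffOn_circ.comp contDiff_fst.contDiffOn hm1).add
      (contDiff_snd.contDiffOn.mul (hβ.comp contDiff_fst.contDiffOn hm1))
  have hGy : ∀ p ∈ interior C ×ˢ K, ∀ y, dirDeriv (0, 1) G (p, y)
      = dirDeriv (0, 1) F (p.1, y) + p.2 * dirDeriv (0, 1) w (p.1, y) := fun p hp y => by
    have hm : (p.1, y) ∈ J ×ˢ (univ : Set ℝ) := ⟨hJ₁J hp.1, mem_univ _⟩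
    exact dirDeriv_right_eq hO hGs hp (fun y => rfl) ((h.hasDerivAt (hJ₁J hp.1) y).add
      ((hasDerivAt_comp_curve (hasDerivAt_mk_right p.1 y)
        (differentiableAt_of_contDiffOn hw h.isOpen_prod hm)).const_mul p.2))
  obtain ⟨Γ, hΓ⟩ := exists_family_isSmoothLift hO hGs hϑs
    (fun p hp y => by
      rw [hGy p hp]
      exact hpos p.1 (interior_subset hp.1) p.2 hp.2 y)
    (fun p hp y => by
      simp only [hG, h.add_two_pi (hJ₁J hp.1), hwp p.1 (hJ₁J hp.1)]
      ring)
  have hΓγ : ∀ p ∈ interior C ×ˢ K, (∀ y, p.2 * w (p.1, y) = 0) → p.2 * β p.1 = 0 →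
      Γ p = γ p.1 := fun p hp e1 e2 => hΓ.eq_of_lift hp
    (fun x => by simp only [hG, e1, add_zero]; exact h.apply_coe _ (hJ₁J hp.1) x)
    (by simp only [hϑ, e2, add_zero]; exact h.circ_eq _ (hJ₁J hp.1))
  have hΓ0 : ∀ t ∈ interior C, Γ (t, 0) = γ t := fun t ht =>
    hΓγ (t, 0) ⟨ht, h0K⟩ (fun y => zero_mul _) (zero_mul _)
  have hfix : ∀ s ∈ K, Γ (t₀, s) = γ t₀ ∧ Γ (t₁, s) = γ t₁ := fun s hs =>
    ⟨hΓγ (t₀, s) ⟨hIC (left_mem_Icc.2 h01.le), hs⟩ (fun y => by simp [hw0]) (by simp [hβ0]),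
      hΓγ (t₁, s) ⟨hIC (right_mem_Icc.2 h01.le), hs⟩ (fun y => by simp [hw1]) (by simp [hβ1])⟩
  obtain ⟨V, hV⟩ := hΓ.exists_isEulerianVelocity (1, 0)
  have key := (hΓ.hasDerivAt_energy hJ₁ hK h01 hIC h0K hfix).unique
    (hgeo _ _ Γ hJ₁ hK hIC h0K hΓ.isSmoothOn (fun t ht => hΓ0 t (hIC ht)) hfix)
  rw [neg_eq_zero] at key
  have hGw : ∀ t ∈ interior C, ∀ y, dirDeriv ((0, 1), 0) G ((t, 0), y) = w (t, y) :=
    fun t ht y => by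
      have hd : HasDerivAt (fun s => F (t, y) + s * w (t, y)) (w (t, y)) 0 := by
        simpa using ((hasDerivAt_id (0 : ℝ)).mul_const (w (t, y))).const_add (F (t, y))
      exact dirDeriv_left_eq (c := fun s => (t, s)) hO hGs (hasDerivAt_line_right t 0) ⟨ht, h0K⟩ hd
  refine ⟨fun t => circVelocity G ϑ (0, 1) (t, 0), fun t ht hwt => ?_, ?_⟩
  · have hp : ((t, 0) : ℝ × ℝ) ∈ interior C ×ˢ K := ⟨hIC ht, h0K⟩
    have hLs (y : ℝ) : dirDeriv ((0, 1), 0) (logSlope G) ((t, 0), y) = 0 := by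
      have : dirDeriv (0, 1) (dirDeriv ((0, 1), 0) G) ((t, 0), y) = 0 :=
        dirDeriv_right_eq hO (contDiffOn_dirDeriv hGs hΓ.isOpen_prod _) hp
          (fun y => (hGw t (hIC ht) y).trans (hwt y)) (hasDerivAt_const y 0)
      rw [hΓ.dirDeriv_logSlope ⟨hp, mem_univ _⟩, this, zero_div]
    have hϑd : dirDeriv (0, 1) ϑ (t, 0) = β t := by
      have hd : HasDerivAt (fun s => θ t + s * β t) (β t) 0 := by
        simpa using ((hasDerivAt_id (0 : ℝ)).mul_const (β t)).const_add (θ t)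
      exact (hasDerivAt_comp_curve (hasDerivAt_line_right t 0)
        (differentiableAt_of_contDiffOn hϑs hO hp)).unique hd
    simp [circVelocity, hLs, hϑd]
  · refine Eq.trans ?_ key
    refine intervalIntegral.integral_congr fun t ht => ?_
    rw [uIcc_of_le h01.le] at ht
    have htC := hIC ht
    have htJ := hIJ ht
    have hp : ((t, 0) : ℝ × ℝ) ∈ interior C ×ˢ K := ⟨htC, h0K⟩
    have hev : ∀ᶠ τ in 𝓝 t, γ τ = Γ (τ, 0) := by
      filter_upwards [hJ₁.mem_nhds htC] with τ hτ using (hΓ0 τ hτ).symm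
    have hev' : ∀ᶠ τ in 𝓝 t, γ τ = γ τ := Filter.Eventually.of_forall fun _ => rfl
    have ha : circVelocity F θ 1 t = circVelocity G ϑ (1, 0) (t, 0) :=
      (h.rightLogDeriv_spec (c := fun τ => τ) (hasDerivAt_id t) htJ hev').2.2.symm.trans
        (hΓ.rightLogDeriv_spec (c := fun τ => (τ, 0)) (hasDerivAt_line_left 0 t) hp hev).2.2
    have ha' : dirDeriv 1 (circVelocity F θ 1) t
        = dirDeriv (1, 0) (circVelocity G ϑ (1, 0)) (t, 0) :=
      (h.hasDerivAt_rightLogDeriv_snd (c := fun τ => τ) hasDerivAt_id htJ hev').unique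
        (hΓ.hasDerivAt_rightLogDeriv_snd (c := fun τ => (τ, 0)) (hasDerivAt_line_left 0) hp hev)
    have hE (y : ℝ) : eulerianKdV U (circVelocity F θ 1 t) 1 (t, F (t, y))
        * dirDeriv (0, 1) F (t, y) = lagrangianKdV G ϑ (1, 0) ((t, 0), y) := by
      rw [hΓ.lagrangianKdV_eq hV hp, ← hΓ.kdv_rightLogDeriv (c := fun τ => (τ, 0)) hV
        (hasDerivAt_line_left 0) hp hev, ← ha, h.kdv_rightLogDeriv (c := fun τ => τ) hU
        hasDerivAt_id htJ hev', hGy _ hp]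
      simp [hG]
    simp only [hE, ha', hGw t htC]

theorem IsGeodesicOn.kdv {J : Set ℝ} {t₀ t₁ : ℝ} {γ : ℝ → VBGroup} {F : ℝ × ℝ → ℝ}
    {θ : ℝ → ℝ} {U : ℝ × ℝ → ℝ} (hgeo : IsGeodesicOn γ t₀ t₁) (h01 : t₀ < t₁)
    (hIJ : Icc t₀ t₁ ⊆ J) (h : IsSmoothLift γ J F θ) (hU : IsEulerianVelocity J F 1 U) :
    (∀ t ∈ Icc t₀ t₁, circVelocity F θ 1 t = circVelocity F θ 1 t₀) ∧
      ∀ t ∈ Icc t₀ t₁, ∀ x, eulerianKdV U (circVelocity F θ 1 t) 1 (t, x) = 0 := by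
  have hO := h.isOpen_prod
  set A := circVelocity F θ 1 with hA
  have hAs : ContDiffOn ℝ ∞ A J := h.contDiffOn_circVelocity 1
  have hA's : ContDiffOn ℝ ∞ (dirDeriv 1 A) J := contDiffOn_dirDeriv hAs h.isOpen 1
  have hbump : ContDiff ℝ ∞ fun t : ℝ => (t - t₀) * (t₁ - t) := by fun_prop
  -- a variation of the circle component shows that `A` is constant
  have hA0 : ∀ t ∈ Icc t₀ t₁, dirDeriv 1 A t = 0 := by
    obtain ⟨b, hb, hint⟩ := hgeo.euler_lagrange h01 hIJ h hU (w := fun _ => 0)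
      (β := fun t => 4 * π * ((t - t₀) * (t₁ - t) * dirDeriv 1 A t)) contDiffOn_const
      (contDiffOn_const.mul (hbump.contDiffOn.mul hA's)) (fun _ _ _ => rfl) (fun _ => rfl)
      (fun _ => rfl) (by simp) (by simp)
    have h2 : ∫ t in t₀..t₁, (t - t₀) * (t₁ - t) * (dirDeriv 1 A t) ^ 2 = 0 := by
      refine Eq.trans ?_ hint
      refine intervalIntegral.integral_congr fun t ht => ?_
      rw [uIcc_of_le h01.le] at ht
      simp only [hb t ht fun _ => rfl, zero_mul, intervalIntegral.integral_zero, zero_add, ← hA]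
      have := Real.pi_pos
      field_simp
    intro t ht
    exact pow_eq_zero_iff two_ne_zero |>.1 (eq_zero_of_integral_bump_mul_eq_zero h01
      ((hA's.continuousOn.mono hIJ).pow 2) (fun t _ => sq_nonneg _) h2 t ht)
  refine ⟨constant_of_has_deriv_right_zero (hAs.continuousOn.mono hIJ) fun t ht => ?_, ?_⟩
  · have htI := Ico_subset_Icc_self ht
    rw [← hA0 t htI]
    exact (hasDerivAt_comp_curve (c := fun τ => τ) (hasDerivAt_id t)
      (differentiableAt_of_contDiffOn hAs h.isOpen (hIJ htI))).hasDerivWithinAt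
  -- a variation of the diffeomorphism component along the KdV expression itself
  have hUd := fun v => contDiffOn_dirDeriv hU.contDiffOn hO v
  set E : ℝ × ℝ → ℝ := fun q => eulerianKdV U (A q.1) 1 q with hE
  have hEs : ContDiffOn ℝ ∞ E (J ×ˢ univ) :=
    ((hUd _).add ((contDiffOn_const.mul hU.contDiffOn).mul (hUd _))).add
      ((hAs.comp contDiff_fst.contDiffOn fun q hq => hq.1).mul
        (contDiffOn_dirDeriv (contDiffOn_dirDeriv (hUd _) hO _) hO _))
  have hUp : ∀ t ∈ J, ∀ x, U (t, x + 2 * π) = U (t, x) + 0 := fun t ht x => by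
    have hr := h.rightLogDeriv_fst (c := fun τ => τ) hU (hasDerivAt_id t) ht
      (Filter.Eventually.of_forall fun _ => rfl)
    rw [← hr, ← hr, (rightLogDeriv γ t).1.periodic x, add_zero]
  have hper1 := fun v t (ht : t ∈ J) x => (dirDeriv_add_period h.isOpen hUp v ht x).trans
    (add_zero _).symm
  have hper2 := fun v w t (ht : t ∈ J) x => (dirDeriv_add_period h.isOpen (hper1 v) w ht x).trans
    (add_zero _).symm
  have hper3 := fun v w z t (ht : t ∈ J) x => dirDeriv_add_period h.isOpen (hper2 v w) z ht x
  have hEp : ∀ t ∈ J, ∀ x, E (t, x + 2 * π) = E (t, x) := fun t ht x => by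
    simp only [hE, eulerianKdV, hper3 _ _ _ t ht, hper1 _ t ht, hUp t ht, add_zero]
  have hEF : ContDiffOn ℝ ∞ (fun q => E (q.1, F q)) (J ×ˢ univ) :=
    hEs.comp (contDiff_fst.contDiffOn.prodMk h.contDiffOn) fun q hq => ⟨hq.1, mem_univ _⟩
  obtain ⟨b, -, hint⟩ := hgeo.euler_lagrange h01 hIJ h hU (β := fun _ => 0)
    (w := fun q => (q.1 - t₀) * (t₁ - q.1) * E (q.1, F q))
    ((hbump.comp contDiff_fst).contDiffOn.mul hEF) contDiffOn_const
    (fun t ht y => by simp only [h.add_two_pi ht, hEp t ht]) (by simp) (by simp) rfl rfl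
  have h2 : ∫ t in t₀..t₁, (t - t₀) * (t₁ - t) * (∫ x in (0 : ℝ)..(2 * π), E (t, x) ^ 2) = 0 := by
    refine Eq.trans ?_ hint
    refine intervalIntegral.integral_congr fun t ht => ?_
    rw [uIcc_of_le h01.le] at ht
    have hc : Continuous fun x => E (t, x) ^ 2 :=
      (IsSmoothLift.contDiff_slice hEs (hIJ ht)).continuous.pow 2
    have hp : Function.Periodic (fun x => E (t, x) ^ 2) (2 * π) := fun x => by
      simp only [hEp t (hIJ ht)]
    simp only [← hA, hA0 t ht, zero_mul, add_zero]
    rw [← integral_comp_isLift (h.isLift (hIJ ht)) hc hp,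
      ← intervalIntegral.integral_const_mul]
    refine intervalIntegral.integral_congr fun y _ => ?_
    simp only [(h.hasDerivAt (hIJ ht) y).deriv, hE]
    ring
  have hcont : ContinuousOn (fun t => ∫ x in (0 : ℝ)..(2 * π), E (t, x) ^ 2) (Icc t₀ t₁) :=
    (contDiffOn_parametric_integral h.isOpen isOpen_univ (hEs.pow 2)
      (subset_univ _)).continuousOn.mono hIJ
  have h3 := eq_zero_of_integral_bump_mul_eq_zero h01 hcont (fun t _ =>
    intervalIntegral.integral_nonneg Real.two_pi_pos.le fun x _ => sq_nonneg _) h2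
  intro t ht x
  let e : VectS1 := ⟨fun x => E (t, x), IsSmoothLift.contDiff_slice hEs (hIJ ht), hEp t (hIJ ht)⟩
  exact e.eq_zero_of_integral_sq (h3 t ht) x

/-- The smoothness of the right logarithmic derivative and the geodesic equation. -/
theorem rightLogDeriv_smooth_and_geodesic_iff (J : Set ℝ) (t₀ t₁ : ℝ) (γ : ℝ → VBGroup)
    (hJ : IsOpen J) (h01 : t₀ < t₁) (hIJ : Icc t₀ t₁ ⊆ J) (hγ : IsSmoothOn γ J) :
    (∀ t ∈ J, HasRightLogDeriv γ t (rightLogDeriv γ t)) ∧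
    ContDiffOn ℝ ∞ (fun p : ℝ × ℝ => (rightLogDeriv γ p.1).1 p.2) (J ×ˢ univ) ∧
    ContDiffOn ℝ ∞ (fun t => (rightLogDeriv γ t).2) J ∧
    (IsGeodesicOn γ t₀ t₁ ↔
      ∃ a : ℝ, ∀ t ∈ Icc t₀ t₁, (rightLogDeriv γ t).2 = a ∧ ∀ x : ℝ,
        deriv (fun τ => (rightLogDeriv γ τ).1 x) t
          + 3 * (rightLogDeriv γ t).1 x * deriv (rightLogDeriv γ t).1 x
          + a * iteratedDeriv 3 (rightLogDeriv γ t).1 x = 0) := by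
  obtain ⟨F, θ, h⟩ := hγ.exists_isSmoothLift hJ
  obtain ⟨U, hU⟩ := h.exists_isEulerianVelocity 1
  have hev : ∀ t, ∀ᶠ τ in 𝓝 t, γ τ = γ τ := fun t => Filter.Eventually.of_forall fun _ => rfl
  have hspec := fun t (ht : t ∈ J) =>
    h.rightLogDeriv_spec (c := fun τ => τ) (hasDerivAt_id t) ht (hev t)
  refine ⟨fun t ht => (hspec t ht).1, hU.contDiffOn.congr fun p hp =>
    h.rightLogDeriv_fst (c := fun τ => τ) hU (hasDerivAt_id p.1) hp.1 (hev _) p.2,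
    (h.contDiffOn_circVelocity 1).congr fun t ht => (hspec t ht).2.2, fun hgeo => ?_,
    fun ⟨a, ha⟩ => isGeodesicOn_of_kdv h01 ha⟩
  obtain ⟨hA, hE⟩ := hgeo.kdv h01 hIJ h hU
  refine ⟨circVelocity F θ 1 t₀, fun t ht => ⟨?_, fun x => ?_⟩⟩
  · rw [(hspec t (hIJ ht)).2.2, hA t ht]
  · rw [h.kdv_rightLogDeriv (c := fun τ => τ) hU hasDerivAt_id (hIJ ht) (hev t), ← hA t ht]
    exact hE t ht x

end VirasoroBott

open VirasoroBott in
theorem mainTheorem5 :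
    -- every element of `ℝ ×_ω 𝔛(S¹)` is the velocity at the unit of a smooth curve in the group
    (∀ X : VirAlg, ∃ (J : Set ℝ) (γ : ℝ → VBGroup), IsOpen J ∧ (0 : ℝ) ∈ J ∧ IsSmoothOn γ J ∧
      γ 0 = 1 ∧ HasRightLogDeriv γ 0 X) ∧
    -- the Lie bracket of the group, `d/dt|₀ d/ds|₀ γ(t) η(s) γ(t)⁻¹`, is that of `ℝ ×_ω 𝔛(S¹)`
    (∀ (J : Set ℝ) (γ η : ℝ → VBGroup) (X Y : VirAlg), IsOpen J → (0 : ℝ) ∈ J →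
      IsSmoothOn γ J → IsSmoothOn η J → γ 0 = 1 → η 0 = 1 →
      HasRightLogDeriv γ 0 X → HasRightLogDeriv η 0 Y →
      ∃ Z : ℝ → VirAlg,
        (∀ t ∈ J, HasRightLogDeriv (fun s => γ t * η s * (γ t)⁻¹) 0 (Z t)) ∧
        (∀ x : ℝ, HasDerivAt (fun t => (Z t).1 x) (⁅X, Y⁆.1 x) 0) ∧
        HasDerivAt (fun t => (Z t).2) ⁅X, Y⁆.2 0) ∧
    -- the adjoint of `ad` exists and is given by the formula
    (∀ (h l : VectS1) (a c : ℝ) (W : VirAlg),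
      IsAdTranspose (h, a) (l, c) W ↔
        (∀ x : ℝ, W.1 x = 2 * deriv h x * l x + h x * deriv l x + c * iteratedDeriv 3 h x) ∧
        W.2 = 0) ∧
    -- the geodesic equation, for a smooth curve on a neighbourhood of `[t₀, t₁]`
    (∀ (J : Set ℝ) (t₀ t₁ : ℝ) (γ : ℝ → VBGroup), IsOpen J → t₀ < t₁ → Set.Icc t₀ t₁ ⊆ J →
      IsSmoothOn γ J →
      (∀ t ∈ J, HasRightLogDeriv γ t (rightLogDeriv γ t)) ∧
      ContDiffOn ℝ (⊤ : ℕ∞) (fun p : ℝ × ℝ => (rightLogDeriv γ p.1).1 p.2) (J ×ˢ Set.univ) ∧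
      ContDiffOn ℝ (⊤ : ℕ∞) (fun t => (rightLogDeriv γ t).2) J ∧
      (IsGeodesicOn γ t₀ t₁ ↔
        ∃ a : ℝ, ∀ t ∈ Set.Icc t₀ t₁,
          (rightLogDeriv γ t).2 = a ∧
          ∀ x : ℝ,
            deriv (fun τ => (rightLogDeriv γ τ).1 x) t
              + 3 * (rightLogDeriv γ t).1 x * deriv (rightLogDeriv γ t).1 x
              + a * iteratedDeriv 3 (rightLogDeriv γ t).1 x = 0)) := by
  exact ⟨exists_curve_hasRightLogDeriv, exists_hasRightLogDeriv_conj, isAdTranspose_iff,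
    rightLogDeriv_smooth_and_geodesic_iff⟩
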